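/- Let $L^2=L^2(\mathbb R)$ with norm $\|\cdot\|$. Let $\lambda>0$, $p\ge 0$, $c\in\mathbb R$, and let $f\in C^1(\mathbb R,\mathbb R)$ satisfy, for all $r\in\mathbb R$, $$f(r)r\ge 0,\qquad f(0)=0,\qquad f'(r)\ge -c,\qquad |f'(r)|\le c(1+|r|^p).$$ Let $g\in L^2_{loc}(\mathbb R;L^2)$ satisfy the tempered condition $\int_{-\infty}^0 e^{\lambda s}\|g(s)\|^2\,ds<\infty$, and let $g_0\in L^2$. Consider, for $x\in\mathbb R$, $$(1)\quad u_t-u_{xx}+\lambda u+f(u)=g(x,t),\ t>\tau,\quad u(\tau)=u_0\in L^2;\qquad (2)\quad u_t-u_{xx}+\lambda u+f(u)=g_0(x),\ t>0,\quad u(0)=u_0\in L^2.$$ A (weak) solution on $[\tau,\infty)$ is a function $u\in C([\tau,\infty);L^2)\cap L^2_{loc}([\tau,\infty);H^1(\mathbb R))$ with $u(\tau)=u_0$ and $f(u)\in L^1_{loc}([\tau,\infty)\times\mathbb R)$ such that, for every $\varphi\in C_c^\infty(\mathbb R)$ and $t\ge\tau$, $$\int u(t)\varphi\,dx=\int u_0\varphi\,dx+\int_\tau^t\!\int\big(g\varphi-u_x\varphi'-\lambda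 u\varphi-f(u)\varphi\big)\,dx\,ds,$$ where in case (2) $\tau=0$ and $g$ is replaced by $g_0$. Assume that (1), for every $\tau\in\mathbb R$ and $u_0\in L^2$, and (2), for every $u_0\in L^2$, have unique solutions, and denote by $U(t,\tau,u_0)$, $t\ge\tau$, and $S(t,u_0)$, $t\ge 0$, their values at time $t$. Put $\operatorname{dist}(A,B)=\sup_{a\in A}\inf_{b\in B}\|a-b\|$. Assume further that: - $U$ has a pullback attractor $\{A(t)\}_{t\in\mathbb R}$ in $L^2$, i.e. a family of nonempty compact sets with $U(t,\tau,A(\tau))=A(t)$ for all $t\ge\tau$ and $\lim_{\tau\to-\infty}\operatorname{dist}(U(t,\tau,D),A(t))=0$ for every $t\in\mathbb R$ and every nonempty bounded $D\subset L^2$, which is the minimal family of nonempty compact sets with these two properties; - $S$ has a global attractor $\mathcal A$ in $L^2$, i.e. a nonempty compact set with $S(t,\mathcal A)=\mathcal A$ for all $t\ge0$ and $\lim_{t\to\infty}\operatorname{dist}(S(t,D),\mathcal A)=0$ for every nonempty bounded $D\subset L^2$. If $$\lim_{\tau\to\infty}\int_\tau^\infty\|g(s)-g_0\|^2\,ds=0,$$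 then $$\lim_{t\to\infty}\operatorname{dist}\big(A(t),\mathcal A\big)=0.$$ -/

import Mathlib

open Set Filter Topology MeasureTheory
open scoped ENNReal

/-- The phase space `L²(ℝ)` of real-valued square-integrable functions (Lebesgue measure). -/
abbrev L2R : Type := Lp ℝ 2 (volume : Measure ℝ)

/-! ### Attractors of processes and semigroups on a metric space -/

section Attractors

variable {X : Type*} [MetricSpace X]

/-- The Hausdorff semi-distance `dist(A, B) = sup_{a ∈ A} inf_{b ∈ B} d(a, b)`, with values in
`[0, ∞]`, so that no supremum or infimum has a junk value. -/
noncomputable def hausdorffSemiDist (A B : Set X) : ℝ≥0∞ :=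
  ⨆ a ∈ A, Metric.infEDist a B

/-- The family `K = {K(t)}` is compact, with nonempty fibres. -/
def IsCompactFamily (K : ℝ → Set X) : Prop :=
  ∀ t, (K t).Nonempty ∧ IsCompact (K t)

/-- Invariance of `K` under `U`: `U(t, τ, K(τ)) = K(t)` for all `t ≥ τ`.
Here `U t τ x` is the state at time `t` of the motion that is in `x` at time `τ`. -/
def IsInvariantFamily (U : ℝ → ℝ → X → X) (K : ℝ → Set X) : Prop :=
  ∀ τ t, τ ≤ t → U t τ '' K τ = K t

/-- `K` pullback attracts every nonempty bounded set `D`: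
`dist(U(t, τ, D), K(t)) → 0` as `τ → -∞`, for every fixed `t`. -/
def PullbackAttracts (U : ℝ → ℝ → X → X) (K : ℝ → Set X) : Prop :=
  ∀ D : Set X, D.Nonempty → Bornology.IsBounded D →
    ∀ t, Tendsto (fun τ => hausdorffSemiDist (U t τ '' D) (K t)) atBot (𝓝 0)

/-- The pullback attractor of `U`: a compact family that is invariant and pullback attracts
nonempty bounded sets, and is the minimal one among such families. -/
structure IsPullbackAttractor (U : ℝ → ℝ → X → X) (A : ℝ → Set X) : Prop where
  compact : IsCompactFamily A
  invariant : IsInvariantFamily U A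
  attracts : PullbackAttracts U A
  minimal : ∀ K : ℝ → Set X, IsCompactFamily K → IsInvariantFamily U K → PullbackAttracts U K →
    ∀ t, A t ⊆ K t

/-- The global attractor of the semigroup `S t`, `t ≥ 0`: a nonempty compact set that is invariant
and attracts every nonempty bounded set. -/
structure IsGlobalAttractor (S : ℝ → X → X) (A : Set X) : Prop where
  nonempty : A.Nonempty
  compact : IsCompact A
  invariant : ∀ t, 0 ≤ t → S t '' A = A
  attracts : ∀ D : Set X, D.Nonempty → Bornology.IsBounded D →
    Tendsto (fun t => hausdorffSemiDist (S t '' D) A) atTop (𝓝 0)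

end Attractors

/-! ### Weak solutions of the reaction-diffusion equation -/

/-- Test functions on the line: smooth with compact support. -/
def IsTestFunction (φ : ℝ → ℝ) : Prop :=
  ContDiff ℝ (⊤ : ℕ∞) φ ∧ HasCompactSupport φ

/-- `v ∈ L²(ℝ)` is the weak derivative of `u ∈ L²(ℝ)`; thus `u ∈ H¹(ℝ)`. -/
def HasWeakDerivative (u v : L2R) : Prop :=
  ∀ φ : ℝ → ℝ, IsTestFunction φ → ∫ x, u x * deriv φ x = - ∫ x, v x * φ x

/-- `h ∈ L²_loc([τ, ∞); L²(ℝ))`. -/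
def MemL2Loc (τ : ℝ) (h : ℝ → L2R) : Prop :=
  ∀ T, MemLp h 2 (volume.restrict (Icc τ T))

/-- `u : [τ, ∞) → L²(ℝ)` is a weak solution of
`u_t - u_xx + lam u + f(u) = g(x, t)` with `u(τ) = u₀`
(the values `u t` for `t < τ` are irrelevant):
`u ∈ C([τ, ∞); L²(ℝ)) ∩ L²_loc([τ, ∞); H¹(ℝ))`, `f(u)` is locally integrable on `[τ, ∞) × ℝ`,
and the equation, integrated over `[τ, t]`, holds against every spatial test function. -/
structure IsWeakSolution (lam : ℝ) (f : ℝ → ℝ) (g : ℝ → L2R) (τ : ℝ) (u₀ : L2R)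
    (u : ℝ → L2R) : Prop where
  continuousOn : ContinuousOn u (Ici τ)
  initial : u τ = u₀
  locallyIntegrable : ∀ T R : ℝ,
    ∫⁻ t in Icc τ T, ∫⁻ x in Icc (-R) R, ‖f (u t x)‖ₑ < ∞
  equation : ∃ v : ℝ → L2R, MemL2Loc τ v ∧
    (∀ᵐ t ∂(volume.restrict (Ici τ)), HasWeakDerivative (u t) (v t)) ∧
    ∀ φ : ℝ → ℝ, IsTestFunction φ → ∀ t, τ ≤ t →
      ∫ x, u t x * φ x = (∫ x, u₀ x * φ x) +
        ∫ s in τ..t, ((∫ x, g s x * φ x) - (∫ x, v s x * deriv φ x)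
          - lam * (∫ x, u s x * φ x) - ∫ x, f (u s x) * φ x)

/-- `u` is the unique weak solution on `[τ, ∞)` with initial value `u₀` at time `τ`. -/
def IsUniqueWeakSolution (lam : ℝ) (f : ℝ → ℝ) (g : ℝ → L2R) (τ : ℝ) (u₀ : L2R)
    (u : ℝ → L2R) : Prop :=
  IsWeakSolution lam f g τ u₀ u ∧
    ∀ w, IsWeakSolution lam f g τ u₀ w → EqOn w u (Ici τ)

/-!
The fibre `A (t + T)` of the pullback attractor is `U (t + T) t (A t)`. Over the fixed span `T` the
process `U` started at a late time `t` differs little from the semigroup `S`, uniformly on bounded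
sets of initial values, and `S T` carries bounded sets close to the global attractor. So it is
enough that the fibres `A t` are bounded uniformly for large `t`
(`tendsto_hausdorffSemiDist_of_asymptotically_autonomous`). Closeness and boundedness both follow
from one energy inequality, applied to the difference of two solutions
(`IsWeakSolution.norm_sub_sq_le`) and to a single one (`IsWeakSolution.norm_sq_le`):
`‖w t‖² - ‖w s‖² ≤ 2 ∫ (‖h‖ ‖w‖ + (κ - lam) ‖w‖²)` whenever `w_t = w_xx - lam w - F + h` weakly and
`F w ≥ -κ w²`; here `F` is `f(u₁) - f(u₂)` with `κ = c`, or `f(u)` with `κ = 0`.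

The difficulty is that the growth exponent is arbitrary and `F` is only locally integrable, so `w`
itself is not an admissible test function. The inequality is therefore proved in renormalised form
(`IsWeakEvolution.renormalized_inequality`). With a mollifier `J`, a cutoff `χ`, and a convex `η`
with bounded derivative `β`, consider `∫ χ η(J w(t))`. By convexity its increments are bounded by
`∫ (w(t) - w(s)) J(χ β(J w(t)))`, in which a genuine test function appears, so that the weak
formulation applies; summing over a partition of the time interval and refining it
(`sub_le_integral_diagonal`) replaces the chain rule in time. On the diagonal the diffusion produces
the nonnegative term `∫ χ β'(J w) (J v)²`, which is dropped, `v` being the weak derivative of `w`.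
When the width of the mollifier tends to zero, `J(χ β(J w))` stays bounded and converges to
`χ β(w)` at every Lebesgue point of `w` (`ae_tendsto_mollify_comp_mollify`), so dominated
convergence suffices against the merely integrable `F`. Finally `χ` tends to `1` and `η(r)` to
`r² / 2` (`IsWeakEvolution.energy_inequality`).

A curve with values in `L²(ℝ)` comes with a representative for each time and no joint measurability
in time and space. Only pairings with test functions are used, and their measurability in time is
obtained from continuous functionals on `L²(ℝ)` (`aestronglyMeasurable_integral_comp`).
-/

/-! ### Mollification on the line -/

open scoped Convolution in
/-- Convolution of `z` with the normalised smooth bump `ρ`. -/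
noncomputable def mollify (ρ : ContDiffBump (0 : ℝ)) (z : ℝ → ℝ) : ℝ → ℝ :=
  ρ.normed volume ⋆[ContinuousLinearMap.lsmul ℝ ℝ, volume] z

section Mollify

variable {ρ : ContDiffBump (0 : ℝ)} {z ψ : ℝ → ℝ}

theorem mollify_apply (ρ : ContDiffBump (0 : ℝ)) (z : ℝ → ℝ) (x : ℝ) :
    mollify ρ z x = ∫ y, z y * ρ.normed volume (x - y) := by
  rw [mollify, convolution_lsmul_swap]
  exact integral_congr_ae (ae_of_all _ fun y => by simp [mul_comm])

theorem contDiff_mollify (hz : LocallyIntegrable z) : ContDiff ℝ (⊤ : ℕ∞) (mollify ρ z) :=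
  (ρ.hasCompactSupport_normed (μ := volume)).contDiff_convolution_left _ ρ.contDiff_normed hz

theorem continuous_mollify (hz : LocallyIntegrable z) : Continuous (mollify ρ z) :=
  (contDiff_mollify hz).continuous

theorem hasDerivAt_mollify (hz : LocallyIntegrable z) (x : ℝ) :
    HasDerivAt (mollify ρ z) (∫ y, z y * deriv (ρ.normed volume) (x - y)) x := by
  have h := ρ.hasCompactSupport_normed.hasDerivAt_convolution_left (μ := volume)
    (ContinuousLinearMap.lsmul ℝ ℝ) (ρ.contDiff_normed (μ := volume) (n := 1)) hz x
  rw [convolution_lsmul_swap] at h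
  simp only [smul_eq_mul, mul_comm] at h
  exact h

theorem isTestFunction_bump_shift (ρ : ContDiffBump (0 : ℝ)) (x : ℝ) :
    IsTestFunction fun y => ρ.normed volume (x - y) := by
  refine ⟨ρ.contDiff_normed.comp (contDiff_const.sub contDiff_id), ?_⟩
  exact ρ.hasCompactSupport_normed.comp_homeomorph (Homeomorph.subLeft x)

theorem isTestFunction_mollify (hψ : Continuous ψ) (hc : HasCompactSupport ψ) :
    IsTestFunction (mollify ρ ψ) :=
  ⟨contDiff_mollify hψ.locallyIntegrable,
    HasCompactSupport.convolution _ ρ.hasCompactSupport_normed hc⟩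

theorem locallyIntegrable_Lp (w : L2R) : LocallyIntegrable w :=
  (Lp.memLp w).locallyIntegrable (by norm_num)

/-- Mollification turns the weak derivative into the classical one. -/
theorem HasWeakDerivative.hasDerivAt_mollify {w v : L2R} (h : HasWeakDerivative w v) (x : ℝ) :
    HasDerivAt (mollify ρ w) (mollify ρ v x) x := by
  convert _root_.hasDerivAt_mollify (ρ := ρ) (locallyIntegrable_Lp w) x using 1
  have h1 := h _ (isTestFunction_bump_shift ρ x)
  have h2 : ∀ y, deriv (fun y => ρ.normed volume (x - y)) y
      = - deriv (ρ.normed volume) (x - y) := fun y => deriv_comp_const_sub _ x y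
  simp only [h2, mul_neg, integral_neg, neg_inj] at h1
  rw [mollify_apply, h1]

theorem hasDerivAt_mollify_of_contDiff (hψ : ContDiff ℝ 1 ψ) (hc : HasCompactSupport ψ) (x : ℝ) :
    HasDerivAt (mollify ρ ψ) (mollify ρ (deriv ψ) x) x :=
  hc.hasDerivAt_convolution_right _
    (ρ.continuous_normed (μ := volume)).locallyIntegrable hψ x

theorem mollify_eq_zero {R : ℝ} (hρ : ρ.rOut ≤ 1) (hψ : ∀ x, R < |x| → ψ x = 0) {x : ℝ}
    (hx : R + 1 < |x|) : mollify ρ ψ x = 0 := by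
  rw [mollify_apply]
  refine integral_eq_zero_of_ae (ae_of_all _ fun y => ?_)
  by_cases hy : R < |y|
  · simp [hψ y hy]
  · have : x - y ∉ Function.support (ρ.normed volume) := by
      rw [ρ.support_normed_eq, mem_ball_zero_iff, Real.norm_eq_abs, not_lt]
      have := abs_sub_abs_le_abs_sub x y
      linarith [not_lt.1 hy]
    simp [Function.notMem_support.1 this]

theorem abs_mollify_le {C : ℝ} (hz : AEStronglyMeasurable z) (hC : ∀ x, |z x| ≤ C) (x : ℝ) :
    |mollify ρ z x| ≤ C := by
  have h := dist_convolution_le (μ := volume) (f := ρ.normed volume) (g := z) (x₀ := x)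
    (R := ρ.rOut) (z₀ := (0 : ℝ)) ((abs_nonneg _).trans (hC 0))
    ρ.support_normed_eq.subset ρ.nonneg_normed ρ.integral_normed hz
    (fun y _ => by simpa using hC y)
  simpa [mollify] using h

theorem integrable_mul_of_eq_zero {H : ℝ → ℝ} {R C : ℝ} (hH : IntegrableOn H (Icc (-R) R))
    (hψ : AEStronglyMeasurable ψ) (hC : ∀ x, |ψ x| ≤ C) (h0 : ∀ x, R < |x| → ψ x = 0) :
    Integrable fun x => H x * ψ x := by
  have h1 : IntegrableOn (fun x => H x * ψ x) (Icc (-R) R) :=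
    Integrable.mul_bdd (c := C) hH hψ.restrict (ae_of_all _ hC)
  refine (integrableOn_iff_integrable_of_support_subset ?_).1 h1
  intro x hx
  by_contra hn
  replace hn : R < |x| := not_le.1 fun h => hn (abs_le.1 h)
  exact hx (by simp [h0 x hn])

theorem MeasureTheory.LocallyIntegrable.integrable_mul_of_hasCompactSupport {φ : ℝ → ℝ}
    (hz : LocallyIntegrable z) (hφ : Continuous φ) (hc : HasCompactSupport φ) : Integrable fun x => z x * φ x := by
  simpa [mul_comm] using hz.integrable_smul_left_of_hasCompactSupport hφ hc

open scoped Pointwise in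
/-- Mollification is symmetric, the bump being even. -/
theorem integral_mollify_mul (hz : LocallyIntegrable z) (hψ : Integrable ψ)
    (hc : HasCompactSupport ψ) :
    ∫ x, mollify ρ z x * ψ x = ∫ x, z x * mollify ρ ψ x := by
  have hρ := ρ.continuous_normed (μ := volume)
  have hint : Integrable (Function.uncurry fun x y => z y * ρ.normed volume (x - y) * ψ x)
      (volume.prod volume) := by
    -- the kernel is bounded, and vanishes for `y` outside a compact set `K` when `ψ x ≠ 0`
    obtain ⟨C, hC⟩ := hρ.bounded_above_of_compact_support ρ.hasCompactSupport_normed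
    set K : Set ℝ := tsupport ψ + Metric.closedBall 0 ρ.rOut
    have hK : IsCompact K := hc.isCompact.add (isCompact_closedBall _ _)
    have h1 : Integrable (fun p : ℝ × ℝ => |ψ p.1| * (C * |K.indicator z p.2|))
        (volume.prod volume) :=
      hψ.abs.mul_prod
        (((hz.integrableOn_isCompact hK).integrable_indicator hK.measurableSet).abs.const_mul C)
    refine h1.mono' ?_ (ae_of_all _ fun p => ?_)
    · exact (hz.aestronglyMeasurable.comp_snd.mul
        (hρ.comp (continuous_fst.sub continuous_snd)).aestronglyMeasurable).mul
          hψ.aestronglyMeasurable.comp_fst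
    · rcases p with ⟨x, y⟩
      simp only [Function.uncurry, norm_mul, Real.norm_eq_abs]
      by_cases hy : y ∈ K
      · rw [indicator_of_mem hy]
        have := hC (x - y)
        rw [Real.norm_eq_abs] at this
        calc |z y| * |ρ.normed volume (x - y)| * |ψ x| ≤ |z y| * C * |ψ x| := by gcongr
          _ = _ := by ring
      · have : ψ x * ρ.normed volume (x - y) = 0 := by
          by_contra hne
          obtain ⟨h1, h2⟩ := mul_ne_zero_iff.1 hne
          have h3 : x - y ∈ Metric.ball (0 : ℝ) ρ.rOut := by
            rw [← ρ.support_normed_eq (μ := volume)]; exact h2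
          refine hy ⟨x, subset_tsupport _ h1, y - x, ?_, by ring⟩
          rw [mem_ball_zero_iff] at h3
          rw [mem_closedBall_zero_iff, ← norm_neg, neg_sub]
          exact h3.le
        rcases mul_eq_zero.1 this with h | h <;> simp [h, hy]
  calc ∫ x, mollify ρ z x * ψ x = ∫ x, ∫ y, z y * ρ.normed volume (x - y) * ψ x := by
        simp_rw [mollify_apply, integral_mul_const]
    _ = ∫ y, ∫ x, z y * ρ.normed volume (x - y) * ψ x := integral_integral_swap hint
    _ = ∫ y, z y * mollify ρ ψ y := by
        refine integral_congr_ae (ae_of_all _ fun y => ?_)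
        simp only [mollify_apply]
        rw [← integral_const_mul]
        refine integral_congr_ae (ae_of_all _ fun x => ?_)
        simp only
        rw [← neg_sub, ρ.normed_neg]
        ring

/-- A sequence of bumps shrinking to the origin. -/
noncomputable def shrinkingBump (n : ℕ) : ContDiffBump (0 : ℝ) where
  rIn := 1 / (2 * (n + 1))
  rOut := 1 / (n + 1)
  rIn_pos := by positivity
  rIn_lt_rOut := by
    have : (0 : ℝ) < n + 1 := by positivity
    exact one_div_lt_one_div_of_lt this (by linarith)

theorem rOut_shrinkingBump (n : ℕ) : (shrinkingBump n).rOut = 1 / (n + 1) := rfl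

theorem rOut_shrinkingBump_le_one (n : ℕ) : (shrinkingBump n).rOut ≤ 1 := by
  rw [rOut_shrinkingBump, div_le_one (by positivity)]
  have : (0 : ℝ) ≤ n := by positivity
  linarith

theorem tendsto_rOut_shrinkingBump :
    Tendsto (fun n => (shrinkingBump n).rOut) atTop (𝓝 0) :=
  tendsto_one_div_add_atTop_nhds_zero_nat

/-- At almost every point `x` the mollifications of a locally integrable function converge to its
value, uniformly at distance from `x` comparable to the width of the bump. -/
theorem ae_tendsto_mollify_uniform (hz : LocallyIntegrable z) :
    ∀ᵐ x, ∀ ε > 0, ∀ᶠ n in atTop, ∀ y ∈ Metric.closedBall x (shrinkingBump n).rOut,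
      |mollify (shrinkingBump n) z y - z x| < ε := by
  filter_upwards [(Besicovitch.vitaliFamily volume).ae_tendsto_average_norm_sub hz] with x hx
  have key : ∀ k : ℕ → ℝ, (∀ n, k n ∈ Metric.closedBall x (shrinkingBump n).rOut) →
      Tendsto (fun n => mollify (shrinkingBump n) z (k n)) atTop (𝓝 (z x)) := by
    intro k hk
    have hr : Tendsto (fun n => 2 * (shrinkingBump n).rOut) atTop (𝓝[>] 0) :=
      tendsto_nhdsWithin_iff.2 ⟨by simpa using tendsto_rOut_shrinkingBump.const_mul 2,
        Eventually.of_forall fun n => mul_pos two_pos (shrinkingBump n).rOut_pos⟩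
    have h1 := (hx.comp (Besicovitch.tendsto_filterAt volume x)).comp hr
    have h2 := tendsto_integral_smul_of_tendsto_average_norm_sub
      (g := fun n y => (shrinkingBump n).normed volume (k n - y)) 4 h1 ?_ ?_ ?_ ?_
    · refine h2.congr fun n => ?_
      rw [mollify_apply]
      exact integral_congr_ae (ae_of_all _ fun y => by simp [mul_comm])
    · exact Eventually.of_forall fun n => hz.integrableOn_isCompact (isCompact_closedBall _ _)
    · refine tendsto_const_nhds.congr fun n => ?_
      rw [integral_sub_left_eq_self (fun y => (shrinkingBump n).normed volume y) volume (k n),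
        ContDiffBump.integral_normed]
    · refine Eventually.of_forall fun n y hy => ?_
      have h3 : k n - y ∈ Metric.ball (0 : ℝ) (shrinkingBump n).rOut := by
        rw [← (shrinkingBump n).support_normed_eq (μ := volume)]; exact hy
      have h4 := hk n
      rw [mem_ball_zero_iff, Real.norm_eq_abs, abs_lt] at h3
      rw [Metric.mem_closedBall, Real.dist_eq, abs_le] at h4
      simp only [Metric.mem_closedBall, Real.dist_eq, abs_le]
      constructor <;> linarith
    · refine Eventually.of_forall fun n y => ?_
      have h3 := (shrinkingBump n).normed_le_div_measure_closedBall_rOut volume 2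
        (by simp only [shrinkingBump]; field_simp; norm_num) (k n - y)
      rw [abs_of_nonneg ((shrinkingBump n).nonneg_normed _)]
      have hp := (shrinkingBump n).rOut_pos
      simp only [Real.volume_real_closedBall hp.le,
        Real.volume_real_closedBall (by positivity : 0 ≤ 2 * (shrinkingBump n).rOut)] at h3 ⊢
      refine h3.trans (le_of_eq ?_)
      simp only [Module.finrank_self, pow_one]
      field_simp
      norm_num
  intro ε hε
  -- otherwise a sequence of bad points would contradict the convergence along it
  classical
  let P : ℕ → ℝ → Prop := fun n y =>
    y ∈ Metric.closedBall x (shrinkingBump n).rOut ∧ ε ≤ |mollify (shrinkingBump n) z y - z x|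
  let k : ℕ → ℝ := fun n => if h : ∃ y, P n y then h.choose else x
  have hk : ∀ n, k n ∈ Metric.closedBall x (shrinkingBump n).rOut := by
    intro n
    by_cases h : ∃ y, P n y
    · simp only [k, dif_pos h]; exact h.choose_spec.1
    · simp only [k, dif_neg h]; exact Metric.mem_closedBall_self (shrinkingBump n).rOut_pos.le
  filter_upwards [Metric.tendsto_nhds.1 (key k hk) ε hε] with n hn y hy
  by_contra hcon
  have h : ∃ y, P n y := ⟨y, hy, not_lt.1 hcon⟩
  have h5 : ε ≤ |mollify (shrinkingBump n) z (k n) - z x| := by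
    simp only [k, dif_pos h]; exact h.choose_spec.2
  rw [Real.dist_eq] at hn
  exact absurd hn (not_lt.2 h5)

theorem ae_tendsto_mollify (hz : LocallyIntegrable z) :
    ∀ᵐ x, Tendsto (fun n => mollify (shrinkingBump n) z x) atTop (𝓝 (z x)) := by
  filter_upwards [ae_tendsto_mollify_uniform hz] with x hx
  refine Metric.tendsto_nhds.2 fun ε hε => ?_
  filter_upwards [hx ε hε] with n hn
  exact hn x (Metric.mem_closedBall_self (shrinkingBump n).rOut_pos.le)

/-- The twofold mollification `J (χ · b(J z))` converges almost everywhere. -/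
theorem ae_tendsto_mollify_comp_mollify {χ b : ℝ → ℝ} (hz : LocallyIntegrable z)
    (hχ : Continuous χ) (hb : Continuous b) :
    ∀ᵐ x, Tendsto (fun n => mollify (shrinkingBump n)
      (fun y => χ y * b (mollify (shrinkingBump n) z y)) x) atTop (𝓝 (χ x * b (z x))) := by
  filter_upwards [ae_tendsto_mollify_uniform hz] with x hx
  refine Metric.tendsto_nhds.2 fun ε hε => ?_
  have hcont : ContinuousAt (fun p : ℝ × ℝ => χ p.1 * b p.2) (x, z x) := by fun_prop
  obtain ⟨δ, hδ, hball⟩ := Metric.continuousAt_iff.1 hcont (ε / 2) (half_pos hε)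
  filter_upwards [hx δ hδ, (tendsto_order.1 tendsto_rOut_shrinkingBump).2 δ hδ] with n hn hr
  refine lt_of_le_of_lt ?_ (half_lt_self hε)
  refine dist_convolution_le (half_pos hε).le
    (shrinkingBump n).support_normed_eq.subset (shrinkingBump n).nonneg_normed
    (shrinkingBump n).integral_normed
    (hχ.mul (hb.comp (continuous_mollify hz))).aestronglyMeasurable fun y hy => ?_
  refine (@hball (y, mollify (shrinkingBump n) z y) ?_).le
  rw [Prod.dist_eq]
  refine max_lt ((Metric.mem_ball.1 hy).trans hr) ?_
  rw [Real.dist_eq]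
  exact hn y (Metric.ball_subset_closedBall hy)

end Mollify

/-! ### Passing from increments to the diagonal -/

section Diagonal

variable {s t : ℝ} {b : ℝ → ℝ → ℝ}

/-- The right end point of the cell containing `r` in the partition of `(s, t]` into `n + 1` equal
cells. -/
noncomputable def gridPoint (s t : ℝ) (n : ℕ) (r : ℝ) : ℝ :=
  min t (s + ⌈(r - s) / ((t - s) / (n + 1))⌉₊ * ((t - s) / (n + 1)))

theorem gridPoint_mem (hst : s < t) (n : ℕ) (r : ℝ) : gridPoint s t n r ∈ Icc s t := by
  have : 0 < (t - s) / (n + 1) := div_pos (sub_pos.2 hst) (by positivity)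
  exact ⟨le_min hst.le (by nlinarith [Nat.cast_nonneg (α := ℝ) ⌈(r - s) / ((t - s) / (n + 1))⌉₊]),
    min_le_left _ _⟩

theorem tendsto_gridPoint {r : ℝ} (hr : r ∈ Ioc s t) :
    Tendsto (fun n => gridPoint s t n r) atTop (𝓝[Icc s t] r) := by
  have hst : s < t := hr.1.trans_le hr.2
  have hlim : Tendsto (fun n : ℕ => r + (t - s) / (n + 1)) atTop (𝓝 r) := by
    have h := (tendsto_one_div_add_atTop_nhds_zero_nat (𝕜 := ℝ)).const_mul (t - s)
    simpa [div_eq_mul_inv] using h.const_add r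
  refine tendsto_nhdsWithin_iff.2
    ⟨tendsto_of_tendsto_of_tendsto_of_le_of_le tendsto_const_nhds hlim (fun n => ?_) (fun n => ?_),
      Eventually.of_forall fun n => gridPoint_mem hst n r⟩
  all_goals
    have hh : 0 < (t - s) / ((n : ℝ) + 1) := div_pos (sub_pos.2 hst) (by positivity)
    have hq : 0 ≤ (r - s) / ((t - s) / ((n : ℝ) + 1)) := div_nonneg (by linarith [hr.1]) hh.le
  · refine le_min hr.2 ?_
    have := Nat.le_ceil ((r - s) / ((t - s) / ((n : ℝ) + 1)))
    rw [div_le_iff₀ hh] at this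
    linarith
  · refine (min_le_right _ _).trans ?_
    have := (Nat.ceil_lt_add_one hq).le
    have h2 := mul_le_mul_of_nonneg_right this hh.le
    rw [add_mul, div_mul_cancel₀ _ hh.ne'] at h2
    linarith

theorem aestronglyMeasurable_gridPoint (hst : s < t)
    (hb : ∀ q ∈ Icc s t, AEStronglyMeasurable (fun r => b r q) (volume.restrict (Ioc s t)))
    (n : ℕ) :
    AEStronglyMeasurable (fun r => b r (gridPoint s t n r)) (volume.restrict (Ioc s t)) := by
  set h := (t - s) / ((n : ℝ) + 1)
  have hh : 0 < h := div_pos (sub_pos.2 hst) (by positivity)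
  have hmem : ∀ j : ℕ, min t (s + j * h) ∈ Icc s t := fun j =>
    ⟨le_min hst.le (by nlinarith [Nat.cast_nonneg (α := ℝ) j]), min_le_left _ _⟩
  have hF := fun j : ℕ => hb _ (hmem j)
  have hk : Measurable fun r : ℝ => ⌈(r - s) / h⌉₊ :=
    Nat.measurable_ceil.comp ((measurable_id.sub_const s).div_const h)
  have hG : Measurable fun p : ℕ × ℝ => (hF p.1).mk _ p.2 :=
    measurable_from_prod_countable_right fun j => (hF j).stronglyMeasurable_mk.measurable
  refine ⟨fun r => (hF ⌈(r - s) / h⌉₊).mk _ r,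
    (hG.comp (hk.prodMk measurable_id)).stronglyMeasurable, ?_⟩
  filter_upwards [ae_all_iff.2 fun j => (hF j).ae_eq_mk] with r hr
  exact hr _

theorem aestronglyMeasurable_diagonal
    (hb : ∀ q ∈ Icc s t, AEStronglyMeasurable (fun r => b r q) (volume.restrict (Ioc s t)))
    (hc : ∀ᵐ r ∂(volume.restrict (Ioc s t)), ContinuousWithinAt (b r) (Icc s t) r) :
    AEStronglyMeasurable (fun r => b r r) (volume.restrict (Ioc s t)) := by
  rcases le_or_gt t s with hst | hst
  · simp [Ioc_eq_empty (not_lt.2 hst)]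
  refine aestronglyMeasurable_of_tendsto_ae atTop (aestronglyMeasurable_gridPoint hst hb) ?_
  filter_upwards [hc, ae_restrict_mem measurableSet_Ioc] with r hr hmem
  exact hr.tendsto.comp (tendsto_gridPoint hmem)

/-- If every increment of `Ψ` is at most the integral of `b` with its second argument frozen at the
right end point, then it is at most the integral of `b` along the diagonal: sum over the cells of
a partition and refine. -/
theorem sub_le_integral_diagonal (hst : s ≤ t) {Ψ m : ℝ → ℝ}
    (hΨ : ∀ p q, s ≤ p → p ≤ q → q ≤ t → Ψ q - Ψ p ≤ ∫ r in p..q, b r q)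
    (hb : ∀ q ∈ Icc s t, AEStronglyMeasurable (fun r => b r q) (volume.restrict (Ioc s t)))
    (hm : IntegrableOn m (Ioc s t))
    (hbm : ∀ᵐ r ∂(volume.restrict (Ioc s t)), ∀ q ∈ Icc s t, |b r q| ≤ m r)
    (hc : ∀ᵐ r ∂(volume.restrict (Ioc s t)), ContinuousWithinAt (b r) (Icc s t) r) :
    Ψ t - Ψ s ≤ ∫ r in s..t, b r r := by
  rcases hst.eq_or_lt with rfl | hst
  · simp
  have hlim : Tendsto (fun n => ∫ r in s..t, b r (gridPoint s t n r)) atTop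
      (𝓝 (∫ r in s..t, b r r)) := by
    simp_rw [intervalIntegral.integral_of_le hst.le]
    refine tendsto_integral_of_dominated_convergence m
      (aestronglyMeasurable_gridPoint hst hb) hm (fun n => ?_) ?_
    · filter_upwards [hbm] with r hr using hr _ (gridPoint_mem hst n r)
    · filter_upwards [hc, ae_restrict_mem measurableSet_Ioc] with r hr hmem
      exact hr.tendsto.comp (tendsto_gridPoint hmem)
  refine ge_of_tendsto' hlim fun n => ?_
  set h := (t - s) / ((n : ℝ) + 1) with hdef
  have hh : 0 < h := div_pos (sub_pos.2 hst) (by positivity)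
  have hnh : ((n : ℝ) + 1) * h = t - s := by rw [hdef]; field_simp
  let a : ℕ → ℝ := fun i => s + i * h
  have ha0 : a 0 = s := by simp [a]
  have haN : a (n + 1) = t := by simp only [a]; push_cast; linarith
  have hmono : Monotone a := fun i j hij => by
    simp only [a]; gcongr
  have hle : ∀ i < n + 1, a (i + 1) ≤ t := fun i hi => haN ▸ hmono hi
  have hge : ∀ i, s ≤ a i := fun i => ha0 ▸ hmono (Nat.zero_le i)
  have hgrid : ∀ i < n + 1, ∀ r ∈ Ioc (a i) (a (i + 1)), gridPoint s t n r = a (i + 1) := by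
    intro i hi r hr
    have hceil : ⌈(r - s) / h⌉₊ = i + 1 := by
      rw [Nat.ceil_eq_iff (by omega)]
      have h1 := hr.1
      have h2 := hr.2
      simp only [a] at h1 h2
      constructor
      · rw [lt_div_iff₀ hh]; simp only [Nat.add_sub_cancel]; linarith
      · rw [div_le_iff₀ hh]; linarith
    rw [gridPoint, ← hdef, hceil, min_eq_right (hle i hi)]
  have hint : IntervalIntegrable (fun r => b r (gridPoint s t n r)) volume s t := by
    rw [intervalIntegrable_iff_integrableOn_Ioc_of_le hst.le]
    refine hm.mono' (aestronglyMeasurable_gridPoint hst hb n) ?_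
    filter_upwards [hbm] with r hr using hr _ (gridPoint_mem hst n r)
  have hsum := intervalIntegral.sum_integral_adjacent_intervals (μ := volume) (a := a) (n := n + 1)
    (f := fun r => b r (gridPoint s t n r)) fun i hi => hint.mono_set (by
      rw [uIcc_of_le (hmono (Nat.le_succ i)), uIcc_of_le hst.le]
      exact Icc_subset_Icc (hge i) (hle i hi))
  rw [ha0, haN] at hsum
  rw [← hsum]
  calc Ψ t - Ψ s = ∑ i ∈ Finset.range (n + 1), (Ψ (a (i + 1)) - Ψ (a i)) := by
        rw [Finset.sum_range_sub (fun i => Ψ (a i)), ha0, haN]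
    _ ≤ _ := by
        refine Finset.sum_le_sum fun i hi => ?_
        have hi := Finset.mem_range.1 hi
        refine (hΨ _ _ (hge i) (hmono (Nat.le_succ i)) (hle i hi)).trans (le_of_eq ?_)
        refine intervalIntegral.integral_congr_uIoo ?_
        intro r hr
        rw [uIoo_of_le (hmono (Nat.le_succ i))] at hr
        simp only
        rw [hgrid i hi r (Ioo_subset_Ioc_self hr)]

end Diagonal

/-! ### Locally integrable sources -/

section Source

theorem hasCompactSupport_of_eq_zero {ψ : ℝ → ℝ} {R : ℝ} (h0 : ∀ x, R < |x| → ψ x = 0) :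
    HasCompactSupport ψ :=
  HasCompactSupport.intro (isCompact_Icc (a := -R) (b := R)) fun x hx =>
    h0 x (not_le.1 fun h => hx (abs_le.1 h))

theorem deriv_eq_zero_of_eq_zero {ψ : ℝ → ℝ} {R : ℝ} (h0 : ∀ x, R < |x| → ψ x = 0) {x : ℝ}
    (hx : R < |x|) : deriv ψ x = 0 := by
  have : ψ =ᶠ[𝓝 x] fun _ => 0 := by
    filter_upwards [(isOpen_lt continuous_const continuous_abs).mem_nhds hx] with y hy using h0 y hy
  rw [this.deriv_eq, deriv_const]

theorem abs_integral_mul_le {H ψ : ℝ → ℝ} {R C m : ℝ} (hH : IntegrableOn H (Icc (-R) R))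
    (hm : ∫ x in Icc (-R) R, |H x| ≤ m) (hC : ∀ x, |ψ x| ≤ C)
    (h0 : ∀ x, R < |x| → ψ x = 0) : |∫ x, H x * ψ x| ≤ C * m := by
  have hC0 : 0 ≤ C := (abs_nonneg _).trans (hC 0)
  have h1 : ∫ x, H x * ψ x = ∫ x in Icc (-R) R, H x * ψ x := by
    refine (setIntegral_eq_integral_of_forall_compl_eq_zero fun x hx => ?_).symm
    rw [h0 x (not_le.1 fun h => hx (abs_le.1 h)), mul_zero]
  rw [h1, ← Real.norm_eq_abs]
  calc ‖∫ x in Icc (-R) R, H x * ψ x‖ ≤ ∫ x in Icc (-R) R, C * |H x| := by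
        refine norm_integral_le_of_norm_le (hH.abs.const_mul C) (ae_of_all _ fun x => ?_)
        rw [norm_mul, mul_comm]
        exact mul_le_mul_of_nonneg_right (hC x) (norm_nonneg _)
    _ ≤ C * m := by
        rw [integral_const_mul]
        exact mul_le_mul_of_nonneg_left hm hC0

theorem tendsto_integral_mul_of_bounded {ι : Type*} {l : Filter ι} [l.IsCountablyGenerated]
    {H ψ : ℝ → ℝ} {R C : ℝ} {ψs : ι → ℝ → ℝ} (hH : IntegrableOn H (Icc (-R) R))
    (hmeas : ∀ᶠ i in l, AEStronglyMeasurable (ψs i)) (hC : ∀ᶠ i in l, ∀ x, |ψs i x| ≤ C)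
    (h0 : ∀ᶠ i in l, ∀ x, R < |x| → ψs i x = 0) (h0' : ∀ x, R < |x| → ψ x = 0)
    (hlim : ∀ᵐ x, Tendsto (fun i => ψs i x) l (𝓝 (ψ x))) :
    Tendsto (fun i => ∫ x, H x * ψs i x) l (𝓝 (∫ x, H x * ψ x)) := by
  have h1 : ∀ {φ : ℝ → ℝ}, (∀ x, R < |x| → φ x = 0) →
      ∫ x in Icc (-R) R, H x * φ x = ∫ x, H x * φ x := fun h =>
    setIntegral_eq_integral_of_forall_compl_eq_zero fun x hx => by
      rw [h x (not_le.1 fun h => hx (abs_le.1 h)), mul_zero]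
  have h2 : Tendsto (fun i => ∫ x in Icc (-R) R, H x * ψs i x) l
      (𝓝 (∫ x in Icc (-R) R, H x * ψ x)) := by
    refine tendsto_integral_filter_of_dominated_convergence (fun x => |H x| * C) ?_ ?_
      (hH.abs.mul_const C) ?_
    · filter_upwards [hmeas] with i hi
      exact hH.aestronglyMeasurable.mul hi.restrict
    · filter_upwards [hC] with i hi
      refine ae_of_all _ fun x => ?_
      rw [norm_mul]
      exact mul_le_mul_of_nonneg_left (hi x) (norm_nonneg _)
    · filter_upwards [ae_restrict_of_ae hlim] with x hx using hx.const_mul _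
  rw [h1 h0'] at h2
  refine h2.congr' ?_
  filter_upwards [h0] with i hi using h1 hi

/-- A function `H r x` on `[τ, ∞) × ℝ` with the local integrability needed to be paired with test
functions in `x` and integrated over bounded intervals in `r`. Measurability in `r` is asked only
for the pairings, because the representatives of a curve in `L²(ℝ)` need not be jointly
measurable. -/
structure IsSource (τ : ℝ) (H : ℝ → ℝ → ℝ) : Prop where
  measurable : ∀ φ, IsTestFunction φ → ∀ T,
    AEStronglyMeasurable (fun r => ∫ x, H r x * φ x) (volume.restrict (Icc τ T))
  bound : ∀ T R, ∃ m : ℝ → ℝ, IntegrableOn m (Icc τ T) ∧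
    ∀ᵐ r ∂(volume.restrict (Icc τ T)), IntegrableOn (H r) (Icc (-R) R) ∧
      ∫ x in Icc (-R) R, |H r x| ≤ m r

variable {τ : ℝ} {H G : ℝ → ℝ → ℝ}

theorem IsTestFunction.exists_bound {φ : ℝ → ℝ} (hφ : IsTestFunction φ) :
    ∃ R C, (∀ x, R < |x| → φ x = 0) ∧ ∀ x, |φ x| ≤ C := by
  obtain ⟨C, hC⟩ := hφ.1.continuous.bounded_above_of_compact_support hφ.2
  obtain ⟨R, hR⟩ := hφ.2.isCompact.isBounded.subset_closedBall 0
  refine ⟨R, C, fun x hx => ?_, hC⟩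
  by_contra hne
  have := hR (subset_tsupport _ hne)
  rw [mem_closedBall_zero_iff, Real.norm_eq_abs] at this
  linarith

theorem IsSource.ae_integrable (hH : IsSource τ H) (T R : ℝ) :
    ∀ᵐ r ∂(volume.restrict (Icc τ T)), IntegrableOn (H r) (Icc (-R) R) := by
  obtain ⟨m, -, h⟩ := hH.bound T R
  filter_upwards [h] with r hr using hr.1

theorem IsSource.ae_integrable_mul (hH : IsSource τ H) (T : ℝ) {φ : ℝ → ℝ}
    (hφ : IsTestFunction φ) :
    ∀ᵐ r ∂(volume.restrict (Icc τ T)), Integrable fun x => H r x * φ x := by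
  obtain ⟨R, C, h0, hC⟩ := hφ.exists_bound
  filter_upwards [hH.ae_integrable T R] with r hr
  exact integrable_mul_of_eq_zero hr hφ.1.continuous.aestronglyMeasurable hC h0

theorem IsSource.integrableOn (hH : IsSource τ H) (T : ℝ) {φ : ℝ → ℝ} (hφ : IsTestFunction φ) :
    IntegrableOn (fun r => ∫ x, H r x * φ x) (Icc τ T) := by
  obtain ⟨R, C, h0, hC⟩ := hφ.exists_bound
  obtain ⟨m, hm, h⟩ := hH.bound T R
  refine (hm.const_mul C).mono' (hH.measurable φ hφ T) ?_
  filter_upwards [h] with r hr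
  exact abs_integral_mul_le hr.1 hr.2 hC h0

theorem IsSource.sub (hH : IsSource τ H) (hG : IsSource τ G) :
    IsSource τ fun r x => H r x - G r x where
  measurable φ hφ T := by
    refine ((hH.measurable φ hφ T).sub (hG.measurable φ hφ T)).congr ?_
    filter_upwards [hH.ae_integrable_mul T hφ, hG.ae_integrable_mul T hφ] with r h1 h2
    simp only [Pi.sub_apply, sub_mul]
    exact (integral_sub h1 h2).symm
  bound T R := by
    obtain ⟨m, hm, h⟩ := hH.bound T R
    obtain ⟨m', hm', h'⟩ := hG.bound T R
    refine ⟨fun r => m r + m' r, hm.add hm', ?_⟩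
    filter_upwards [h, h'] with r hr hr'
    refine ⟨hr.1.sub hr'.1, ?_⟩
    calc ∫ x in Icc (-R) R, |H r x - G r x|
        ≤ ∫ x in Icc (-R) R, (|H r x| + |G r x|) :=
          integral_mono (hr.1.sub hr'.1).abs (hr.1.abs.add hr'.1.abs) fun x => abs_sub _ _
      _ ≤ m r + m' r := by
          rw [integral_add hr.1.abs hr'.1.abs]
          exact add_le_add hr.2 hr'.2

theorem IsSource.const_mul (hH : IsSource τ H) (a : ℝ) : IsSource τ fun r x => a * H r x where
  measurable φ hφ T := by
    simp only [mul_assoc, integral_const_mul]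
    exact (hH.measurable φ hφ T).const_mul a
  bound T R := by
    obtain ⟨m, hm, h⟩ := hH.bound T R
    refine ⟨fun r => |a| * m r, hm.const_mul _, ?_⟩
    filter_upwards [h] with r hr
    refine ⟨hr.1.const_mul a, ?_⟩
    simp only [abs_mul, integral_const_mul]
    exact mul_le_mul_of_nonneg_left hr.2 (abs_nonneg a)

theorem integral_mul_eq_inner {φ : ℝ → ℝ} (hφ : MemLp φ 2 volume) (w : L2R) :
    ∫ x, w x * φ x = inner ℝ w (hφ.toLp φ) := by
  rw [L2.inner_def]
  refine integral_congr_ae ?_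
  filter_upwards [hφ.coeFn_toLp] with x hx
  simp [hx, mul_comm]

theorem IsTestFunction.deriv {φ : ℝ → ℝ} (hφ : IsTestFunction φ) : IsTestFunction (deriv φ) :=
  ⟨(contDiff_infty_iff_deriv.1 hφ.1).2, hφ.2.deriv⟩

theorem IsTestFunction.memLp {φ : ℝ → ℝ} (hφ : IsTestFunction φ) : MemLp φ 2 volume :=
  hφ.1.continuous.memLp_of_hasCompactSupport hφ.2

theorem norm_sq_eq_integral (w : L2R) : ‖w‖ ^ 2 = ∫ x, w x ^ 2 := by
  rw [← real_inner_self_eq_norm_sq, L2.inner_def]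
  simp [sq]

theorem setIntegral_abs_le (w : L2R) (R : ℝ) :
    ∫ x in Icc (-R) R, |w x| ≤ volume.real (Icc (-R) R) + ‖w‖ ^ 2 := by
  have h1 : IntegrableOn (fun _ : ℝ => (1 : ℝ)) (Icc (-R) R) := integrableOn_const (by simp)
  have h2 : Integrable fun x => w x ^ 2 := (Lp.memLp w).integrable_sq
  calc ∫ x in Icc (-R) R, |w x| ≤ ∫ x in Icc (-R) R, (1 + w x ^ 2) := by
        refine integral_mono ?_ (h1.add h2.integrableOn) fun x => ?_
        · exact ((locallyIntegrable_Lp w).integrableOn_isCompact isCompact_Icc).abs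
        · simp only
          rw [← sq_abs (w x)]
          nlinarith [sq_nonneg (|w x| - 1), sq_nonneg (|w x|)]
    _ ≤ _ := by
        rw [integral_add h1 h2.integrableOn, norm_sq_eq_integral]
        exact add_le_add (by simp) (setIntegral_le_integral h2 (ae_of_all _ fun x => sq_nonneg _))

theorem MemL2Loc.integrableOn_norm_sq {h : ℝ → L2R} (hh : MemL2Loc τ h) (T : ℝ) :
    IntegrableOn (fun r => ‖h r‖ ^ 2) (Icc τ T) :=
  (hh T).norm.integrable_sq

theorem MemL2Loc.isSource {h : ℝ → L2R} (hh : MemL2Loc τ h) : IsSource τ fun r x => h r x where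
  measurable φ hφ T := by
    simp only [integral_mul_eq_inner hφ.memLp]
    exact (hh T).aestronglyMeasurable.inner aestronglyMeasurable_const
  bound T R := ⟨fun r => volume.real (Icc (-R) R) + ‖h r‖ ^ 2,
    (integrableOn_const (by simp)).add (hh.integrableOn_norm_sq T),
    ae_of_all _ fun r => ⟨(locallyIntegrable_Lp (h r)).integrableOn_isCompact isCompact_Icc,
      setIntegral_abs_le _ _⟩⟩

theorem ContinuousOn.memL2Loc {w : ℝ → L2R} (hw : ContinuousOn w (Ici τ)) : MemL2Loc τ w := by
  intro T
  have h1 : ContinuousOn w (Icc τ T) := hw.mono Icc_subset_Ici_self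
  obtain ⟨C, hC⟩ := (isCompact_Icc.image_of_continuousOn h1).isBounded.exists_norm_le
  refine MemLp.of_bound (h1.aestronglyMeasurable_of_isCompact isCompact_Icc measurableSet_Icc) C ?_
  filter_upwards [ae_restrict_mem measurableSet_Icc] with r hr
  exact hC _ (mem_image_of_mem _ hr)

/-- Pairings of a source with a bounded family of test functions depending continuously on a time
parameter `q`. -/
theorem IsSource.exists_pairing_bound (hH : IsSource τ H) {s t : ℝ} (hs : τ ≤ s)
    {R C : ℝ} {φ : ℝ → ℝ → ℝ}
    (hφ : ∀ q ∈ Icc s t, IsTestFunction (φ q)) (hC : ∀ q ∈ Icc s t, ∀ x, |φ q x| ≤ C)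
    (h0 : ∀ q ∈ Icc s t, ∀ x, R < |x| → φ q x = 0)
    (hcont : ∀ x, ContinuousOn (fun q => φ q x) (Icc s t)) :
    (∀ q ∈ Icc s t, AEStronglyMeasurable (fun r => ∫ x, H r x * φ q x)
      (volume.restrict (Ioc s t))) ∧
    ∃ m : ℝ → ℝ, IntegrableOn m (Ioc s t) ∧ ∀ᵐ r ∂(volume.restrict (Ioc s t)),
      (∀ q ∈ Icc s t, |∫ x, H r x * φ q x| ≤ m r) ∧
      ContinuousWithinAt (fun q => ∫ x, H r x * φ q x) (Icc s t) r := by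
  have hsub : Ioc s t ⊆ Icc τ t := fun r hr => ⟨hs.trans hr.1.le, hr.2⟩
  have hle := Measure.restrict_mono_set volume hsub
  refine ⟨fun q hq => (hH.measurable _ (hφ q hq) t).mono_measure hle, ?_⟩
  obtain ⟨m, hm, h⟩ := hH.bound t R
  refine ⟨fun r => C * m r, (hm.mono_set hsub).const_mul C, ?_⟩
  filter_upwards [ae_mono hle h, ae_restrict_mem measurableSet_Ioc] with r hr hmem
  have hrI : r ∈ Icc s t := Ioc_subset_Icc_self hmem
  refine ⟨fun q hq => abs_integral_mul_le hr.1 hr.2 (hC q hq) (h0 q hq), ?_⟩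
  refine tendsto_integral_mul_of_bounded (C := C) hr.1 ?_ ?_ ?_ (h0 r hrI)
    (ae_of_all _ fun x => hcont x r hrI)
  · filter_upwards [self_mem_nhdsWithin] with q hq using
      (hφ q hq).1.continuous.aestronglyMeasurable
  · filter_upwards [self_mem_nhdsWithin] with q hq using hC q hq
  · filter_upwards [self_mem_nhdsWithin] with q hq using h0 q hq

end Source

/-! ### The renormalised inequality -/

/-- The curve `w` in `L²(ℝ)` solves `w_t = v_x + H` on `[τ, ∞)` in the weak sense, `v` being the
weak spatial derivative of `w`. -/
structure IsWeakEvolution (τ : ℝ) (w v : ℝ → L2R) (H : ℝ → ℝ → ℝ) : Prop where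
  continuousOn : ContinuousOn w (Ici τ)
  memL2 : MemL2Loc τ v
  weakDeriv : ∀ᵐ r ∂(volume.restrict (Ici τ)), HasWeakDerivative (w r) (v r)
  source : IsSource τ H
  equation : ∀ φ, IsTestFunction φ → ∀ s t, τ ≤ s → s ≤ t →
    (∫ x, w t x * φ x) - ∫ x, w s x * φ x
      = ∫ r in s..t, ((∫ x, H r x * φ x) - ∫ x, v r x * deriv φ x)

/-- A cutoff `χ` supported in `[-R, R]` and a convex function `η` with bounded derivative `β`. -/
structure IsRenormalization (χ η β : ℝ → ℝ) (R : ℝ) : Prop where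
  contDiff_cutoff : ContDiff ℝ 1 χ
  cutoff_nonneg : ∀ x, 0 ≤ χ x
  cutoff_eq_zero : ∀ x, R < |x| → χ x = 0
  hasDerivAt : ∀ r, HasDerivAt η (β r) r
  contDiff : ContDiff ℝ 1 β
  deriv_nonneg : ∀ r, 0 ≤ deriv β r
  bounded : ∃ k, ∀ r, |β r| ≤ k

namespace IsRenormalization

variable {χ η β : ℝ → ℝ} {R : ℝ}

theorem le_of_convex (h : IsRenormalization χ η β R) (a b : ℝ) : η a - η b ≤ β a * (a - b) := by
  have hmono : Monotone β := monotone_of_deriv_nonneg (h.contDiff.differentiable one_ne_zero)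
    h.deriv_nonneg
  have hη : deriv η = β := funext fun r => (h.hasDerivAt r).deriv
  have hconv : ConvexOn ℝ univ η := Monotone.convexOn_univ_of_deriv
    (fun r => (h.hasDerivAt r).differentiableAt) (hη ▸ hmono)
  rcases lt_trichotomy a b with hab | rfl | hab
  · have := hconv.le_slope_of_hasDerivAt (mem_univ a) (mem_univ b) hab (h.hasDerivAt a)
    rw [slope_def_field, le_div_iff₀ (by linarith)] at this
    linarith
  · simp
  · have := hconv.slope_le_of_hasDerivAt (mem_univ b) (mem_univ a) hab (h.hasDerivAt a)
    rw [slope_def_field, div_le_iff₀ (by linarith)] at this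
    linarith

theorem exists_bounds (h : IsRenormalization χ η β R) :
    ∃ C, ∀ x r, |χ x * β r| ≤ C ∧ |deriv χ x * β r| ≤ C := by
  have hc := hasCompactSupport_of_eq_zero h.cutoff_eq_zero
  obtain ⟨C, hC⟩ := h.contDiff_cutoff.continuous.bounded_above_of_compact_support hc
  obtain ⟨C', hC'⟩ := (h.contDiff_cutoff.continuous_deriv le_rfl).bounded_above_of_compact_support
    hc.deriv
  obtain ⟨k, hk⟩ := h.bounded
  have h1 : 0 ≤ C := (norm_nonneg _).trans (hC 0)
  have h2 : 0 ≤ C' := (norm_nonneg _).trans (hC' 0)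
  have h3 : 0 ≤ k := (abs_nonneg _).trans (hk 0)
  refine ⟨max (C * k) (C' * k), fun x r => ⟨le_max_of_le_left ?_, le_max_of_le_right ?_⟩⟩
  · rw [abs_mul]; exact mul_le_mul (hC x) (hk r) (abs_nonneg _) h1
  · rw [abs_mul]; exact mul_le_mul (hC' x) (hk r) (abs_nonneg _) h2

theorem integrable_cutoff_mul_comp (h : IsRenormalization χ η β R) {z : ℝ → ℝ}
    (hz : LocallyIntegrable z) : Integrable fun x => χ x * η (z x) := by
  obtain ⟨k, hk⟩ := h.bounded
  have hη : Continuous η := continuous_iff_continuousAt.2 fun r => (h.hasDerivAt r).continuousAt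
  have hχ := h.contDiff_cutoff.continuous
  have hc := hasCompactSupport_of_eq_zero h.cutoff_eq_zero
  have h1 : Integrable fun x => (|η 0| + k * |z x|) * χ x :=
    ((locallyIntegrable_const |η 0|).add (LocallyIntegrable.smul (fun x => (hz x).norm) k)).integrable_mul_of_hasCompactSupport hχ hc
  refine h1.mono' (hχ.aestronglyMeasurable.mul
    (hη.comp_aestronglyMeasurable hz.aestronglyMeasurable)) (ae_of_all _ fun x => ?_)
  have h2 := h.le_of_convex (z x) 0
  have h3 := h.le_of_convex 0 (z x)
  have h4 : |β (z x) * (z x)| ≤ k * |z x| := by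
    rw [abs_mul]; exact mul_le_mul_of_nonneg_right (hk _) (abs_nonneg _)
  have h5 : |β 0 * (z x)| ≤ k * |z x| := by
    rw [abs_mul]; exact mul_le_mul_of_nonneg_right (hk _) (abs_nonneg _)
  rw [norm_mul, Real.norm_eq_abs, abs_of_nonneg (h.cutoff_nonneg x), mul_comm]
  refine mul_le_mul_of_nonneg_right ?_ (h.cutoff_nonneg x)
  rw [Real.norm_eq_abs]
  rw [sub_zero] at h2
  rw [zero_sub] at h3
  rw [abs_le] at h4 h5 ⊢
  constructor <;> linarith [neg_abs_le (η 0), le_abs_self (η 0)]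

theorem integral_sub_le (h : IsRenormalization χ η β R) {y z : ℝ → ℝ}
    (hy : LocallyIntegrable y) (hz : LocallyIntegrable z) :
    (∫ x, χ x * η (y x)) - ∫ x, χ x * η (z x)
      ≤ (∫ x, y x * (χ x * β (y x))) - ∫ x, z x * (χ x * β (y x)) := by
  obtain ⟨C, hC⟩ := h.exists_bounds
  have hmeas : AEStronglyMeasurable fun x => χ x * β (y x) :=
    h.contDiff_cutoff.continuous.aestronglyMeasurable.mul
      (h.contDiff.continuous.comp_aestronglyMeasurable hy.aestronglyMeasurable)
  have hint : ∀ {u : ℝ → ℝ}, LocallyIntegrable u → Integrable fun x => u x * (χ x * β (y x)) :=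
    fun hu => integrable_mul_of_eq_zero (hu.integrableOn_isCompact isCompact_Icc) hmeas
      (fun x => (hC x _).1) fun x hx => by rw [h.cutoff_eq_zero x hx, zero_mul]
  rw [← integral_sub (h.integrable_cutoff_mul_comp hy) (h.integrable_cutoff_mul_comp hz),
    ← integral_sub (hint hy) (hint hz)]
  refine integral_mono ((h.integrable_cutoff_mul_comp hy).sub (h.integrable_cutoff_mul_comp hz))
    ((hint hy).sub (hint hz)) fun x => ?_
  have := mul_le_mul_of_nonneg_left (h.le_of_convex (y x) (z x)) (h.cutoff_nonneg x)
  simp only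
  linarith

end IsRenormalization

section Mollified

variable {τ : ℝ} {w v : ℝ → L2R} {H : ℝ → ℝ → ℝ} {χ η β : ℝ → ℝ} {R s t : ℝ}
  {ρ : ContDiffBump (0 : ℝ)}

theorem continuousOn_mollify_apply (hw : ContinuousOn w (Ici τ)) (x : ℝ) :
    ContinuousOn (fun q => mollify ρ (w q) x) (Ici τ) := by
  simp only [mollify_apply]
  have h := (isTestFunction_bump_shift ρ x).memLp
  simp only [integral_mul_eq_inner h]
  exact hw.inner continuousOn_const

theorem continuousOn_integral_mul {S : Set ℝ} {g : ℝ → ℝ} (hg : LocallyIntegrable g) {C : ℝ}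
    {ψ : ℝ → ℝ → ℝ} (hm : ∀ q, AEStronglyMeasurable (ψ q)) (hC : ∀ q x, |ψ q x| ≤ C)
    (h0 : ∀ q x, R < |x| → ψ q x = 0) (hcont : ∀ x, ContinuousOn (fun q => ψ q x) S) :
    ContinuousOn (fun q => ∫ y, ψ q y * g y) S := by
  intro r hr
  simp only [mul_comm (ψ _ _)]
  exact tendsto_integral_mul_of_bounded (hg.integrableOn_isCompact isCompact_Icc)
    (Eventually.of_forall hm) (Eventually.of_forall hC) (Eventually.of_forall h0) (h0 r)
    (ae_of_all _ fun x => hcont x r hr)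

/-- The renormalised inequality before the mollification is removed. The chain rule in time is
replaced by convexity of `η` on small time steps; on the diagonal the term with
`β' (J w) (J v)² ≥ 0` is dropped. -/
theorem IsWeakEvolution.mollified_inequality (hw : IsWeakEvolution τ w v H)
    (h : IsRenormalization χ η β R) (hρ : ρ.rOut ≤ 1) (hs : τ ≤ s) (hst : s ≤ t) :
    AEStronglyMeasurable (fun r =>
      (∫ x, H r x * mollify ρ (fun y => χ y * β (mollify ρ (w r) y)) x)
        - ∫ x, v r x * mollify ρ (fun y => deriv χ y * β (mollify ρ (w r) y)) x)
      (volume.restrict (Ioc s t)) ∧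
    (∫ x, χ x * η (mollify ρ (w t) x)) - ∫ x, χ x * η (mollify ρ (w s) x)
      ≤ ∫ r in s..t, ((∫ x, H r x * mollify ρ (fun y => χ y * β (mollify ρ (w r) y)) x)
        - ∫ x, v r x * mollify ρ (fun y => deriv χ y * β (mollify ρ (w r) y)) x) := by
  obtain ⟨C, hC⟩ := h.exists_bounds
  have hJ : ∀ q, ContDiff ℝ 1 (mollify ρ (w q)) := fun q =>
    (contDiff_mollify (locallyIntegrable_Lp (w q))).of_le (by exact_mod_cast le_top)
  have hχ' := h.contDiff_cutoff.continuous_deriv le_rfl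
  let ψ : ℝ → ℝ → ℝ := fun q y => χ y * β (mollify ρ (w q) y)
  let θ : ℝ → ℝ → ℝ := fun q y => deriv χ y * β (mollify ρ (w q) y)
  have hψ : ∀ q, ContDiff ℝ 1 (ψ q) := fun q => h.contDiff_cutoff.mul (h.contDiff.comp (hJ q))
  have hθ : ∀ q, Continuous (θ q) := fun q =>
    hχ'.mul (h.contDiff.continuous.comp (hJ q).continuous)
  have hψ0 : ∀ q x, R < |x| → ψ q x = 0 := fun q x hx => by
    simp only [ψ, h.cutoff_eq_zero x hx, zero_mul]
  have hθ0 : ∀ q x, R < |x| → θ q x = 0 := fun q x hx => by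
    simp only [θ, deriv_eq_zero_of_eq_zero h.cutoff_eq_zero hx, zero_mul]
  have hψc : ∀ q, HasCompactSupport (ψ q) := fun q => hasCompactSupport_of_eq_zero (hψ0 q)
  have hθc : ∀ q, HasCompactSupport (θ q) := fun q => hasCompactSupport_of_eq_zero (hθ0 q)
  have hJcont : ∀ y, ContinuousOn (fun q => mollify ρ (w q) y) (Icc s t) := fun y =>
    (continuousOn_mollify_apply hw.continuousOn y).mono fun q hq => hs.trans hq.1
  have hψcont : ∀ y, ContinuousOn (fun q => ψ q y) (Icc s t) := fun y =>
    continuousOn_const.mul (h.contDiff.continuous.comp_continuousOn (hJcont y))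
  have hθcont : ∀ y, ContinuousOn (fun q => θ q y) (Icc s t) := fun y =>
    continuousOn_const.mul (h.contDiff.continuous.comp_continuousOn (hJcont y))
  have hφ : ∀ q, IsTestFunction (mollify ρ (ψ q)) := fun q =>
    isTestFunction_mollify (hψ q).continuous (hψc q)
  have hφ' : ∀ q, IsTestFunction (deriv (mollify ρ (ψ q))) := fun q => (hφ q).deriv
  have hρ' : Continuous (deriv (ρ.normed volume)) :=
    (ρ.contDiff_normed (n := 1)).continuous_deriv le_rfl
  have hmollify_cont : ∀ {ζ : ℝ → ℝ → ℝ}, (∀ q, Continuous (ζ q)) → (∀ q x, |ζ q x| ≤ C) →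
      (∀ q x, R < |x| → ζ q x = 0) → (∀ y, ContinuousOn (fun q => ζ q y) (Icc s t)) →
      ∀ x, ContinuousOn (fun q => mollify ρ (ζ q) x) (Icc s t) := by
    intro ζ h1 h2 h3 h4 x
    simp only [mollify_apply]
    exact continuousOn_integral_mul (ρ.continuous_normed.comp
      (continuous_const.sub continuous_id)).locallyIntegrable
      (fun q => (h1 q).aestronglyMeasurable) h2 h3 h4
  -- the three families of pairings
  obtain ⟨meas₁, m₁, hm₁, hb₁⟩ := hw.source.exists_pairing_bound (t := t) hs (R := R + 1) (C := C)
    (φ := fun q => mollify ρ (ψ q)) (fun q _ => hφ q)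
    (fun q _ => abs_mollify_le (hψ q).continuous.aestronglyMeasurable fun x => (hC x _).1)
    (fun q _ x hx => mollify_eq_zero hρ (hψ0 q) hx)
    (hmollify_cont (fun q => (hψ q).continuous) (fun q x => (hC x _).1) hψ0 hψcont)
  obtain ⟨meas₂, m₂, hm₂, hb₂⟩ := hw.memL2.isSource.exists_pairing_bound (t := t) hs (R := R + 1)
    (C := C * ∫ x, |deriv (ρ.normed volume) x|)
    (φ := fun q => deriv (mollify ρ (ψ q))) (fun q _ => hφ' q)
    (fun q _ x => by
      rw [(hasDerivAt_mollify (hψ q).continuous.locallyIntegrable x).deriv]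
      simp only [mul_comm (ψ q _)]
      have hI : Integrable (deriv (ρ.normed volume)) :=
        hρ'.integrable_of_hasCompactSupport ρ.hasCompactSupport_normed.deriv
      have hI' : Integrable fun y => deriv (ρ.normed volume) (x - y) := hI.comp_sub_left x
      refine abs_integral_mul_le (R := R) hI'.integrableOn ?_ (fun y => (hC y _).1) (hψ0 q)
      refine (setIntegral_le_integral hI'.abs (ae_of_all _ fun y => abs_nonneg _)).trans_eq ?_
      exact integral_sub_left_eq_self (fun y => |deriv (ρ.normed volume) y|) volume x)
    (fun q _ x hx => deriv_eq_zero_of_eq_zero (fun y hy => mollify_eq_zero hρ (hψ0 q) hy) hx)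
    (fun x => by
      simp only [fun q => (hasDerivAt_mollify (ρ := ρ) (hψ q).continuous.locallyIntegrable x).deriv]
      exact continuousOn_integral_mul
        (hρ'.comp (continuous_const.sub continuous_id)).locallyIntegrable
        (fun q => (hψ q).continuous.aestronglyMeasurable) (fun q x => (hC x _).1) hψ0 hψcont)
  obtain ⟨meas₃, m₃, hm₃, hb₃⟩ := hw.memL2.isSource.exists_pairing_bound (t := t) hs (R := R + 1)
    (C := C) (φ := fun q => mollify ρ (θ q))
    (fun q _ => isTestFunction_mollify (hθ q) (hθc q))
    (fun q _ => abs_mollify_le (hθ q).aestronglyMeasurable fun x => (hC x _).2)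
    (fun q _ x hx => mollify_eq_zero hρ (hθ0 q) hx)
    (hmollify_cont hθ (fun q x => (hC x _).2) hθ0 hθcont)
  have hmeas : AEStronglyMeasurable (fun r => (∫ x, H r x * mollify ρ (ψ r) x)
      - ∫ x, v r x * mollify ρ (θ r) x) (volume.restrict (Ioc s t)) :=
    (aestronglyMeasurable_diagonal meas₁ (hb₁.mono fun r hr => hr.2)).sub
      (aestronglyMeasurable_diagonal meas₃ (hb₃.mono fun r hr => hr.2))
  refine ⟨hmeas, ?_⟩
  have hdiag := sub_le_integral_diagonal hst (Ψ := fun q => ∫ x, χ x * η (mollify ρ (w q) x))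
    (b := fun r q => (∫ x, H r x * mollify ρ (ψ q) x)
      - ∫ x, v r x * deriv (mollify ρ (ψ q)) x) (m := fun r => m₁ r + m₂ r)
    (fun p q hp hpq _ => by
      rw [← hw.equation _ (hφ q) p q (hs.trans hp) hpq]
      have hJloc : ∀ q, LocallyIntegrable (mollify ρ (w q)) := fun q =>
        (hJ q).continuous.locallyIntegrable
      refine (h.integral_sub_le (hJloc q) (hJloc p)).trans (le_of_eq ?_)
      have hψi := (hψ q).continuous.integrable_of_hasCompactSupport (μ := volume) (hψc q)
      exact congrArg₂ (· - ·) (integral_mollify_mul (ρ := ρ) (locallyIntegrable_Lp (w q)) hψi (hψc q))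
        (integral_mollify_mul (ρ := ρ) (locallyIntegrable_Lp (w p)) hψi (hψc q)))
    (fun q hq => (meas₁ q hq).sub (meas₂ q hq)) (hm₁.add hm₂)
    (by
      filter_upwards [hb₁, hb₂] with r h1 h2 q hq
      exact (abs_sub _ _).trans (add_le_add (h1.1 q hq) (h2.1 q hq)))
    (by
      filter_upwards [hb₁, hb₂] with r h1 h2 using h1.2.sub h2.2)
  refine hdiag.trans ?_
  rw [intervalIntegral.integral_of_le hst, intervalIntegral.integral_of_le hst]
  have hmem : ∀ᵐ r ∂(volume.restrict (Ioc s t)), r ∈ Icc s t :=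
    (ae_restrict_mem measurableSet_Ioc).mono fun r hr => Ioc_subset_Icc_self hr
  refine integral_mono_ae ?_ ?_ ?_
  · refine (hm₁.add hm₂).mono' ((aestronglyMeasurable_diagonal meas₁
      (hb₁.mono fun r hr => hr.2)).sub (aestronglyMeasurable_diagonal meas₂
        (hb₂.mono fun r hr => hr.2))) ?_
    filter_upwards [hb₁, hb₂, hmem] with r h1 h2 hr
    exact (abs_sub _ _).trans (add_le_add (h1.1 r hr) (h2.1 r hr))
  · refine (hm₁.add hm₃).mono' hmeas ?_
    filter_upwards [hb₁, hb₃, hmem] with r h1 h2 hr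
    exact (abs_sub _ _).trans (add_le_add (h1.1 r hr) (h2.1 r hr))
  · have hsub : Ioc s t ⊆ Ici τ := fun r hr => hs.trans hr.1.le
    filter_upwards [ae_mono (Measure.restrict_mono_set volume hsub) hw.weakDeriv] with r hr
    refine sub_le_sub_left ?_ _
    have hloc := locallyIntegrable_Lp (v r)
    have hd : deriv (mollify ρ (ψ r)) = mollify ρ (deriv (ψ r)) := funext fun x =>
      (hasDerivAt_mollify_of_contDiff (hψ r) (hψc r) x).deriv
    have hψ' := (hψ r).continuous_deriv le_rfl
    rw [hd, ← integral_mollify_mul hloc (hψ'.integrable_of_hasCompactSupport (hψc r).deriv)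
      (hψc r).deriv, ← integral_mollify_mul hloc ((hθ r).integrable_of_hasCompactSupport (hθc r))
      (hθc r)]
    have hJv := (continuous_mollify (ρ := ρ) hloc).locallyIntegrable (μ := volume)
    refine integral_mono (hJv.integrable_mul_of_hasCompactSupport (hθ r) (hθc r))
      (hJv.integrable_mul_of_hasCompactSupport hψ' (hψc r).deriv) fun x => ?_
    have hder : deriv (ψ r) x = θ r x
        + χ x * (deriv β (mollify ρ (w r) x) * mollify ρ (v r) x) := by
      have h1 := (h.contDiff_cutoff.differentiable one_ne_zero x).hasDerivAt
      have h2 := (h.contDiff.differentiable one_ne_zero (mollify ρ (w r) x)).hasDerivAt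
      exact (h1.mul (h2.comp x (hr.hasDerivAt_mollify x))).deriv
    simp only
    rw [hder]
    have := mul_nonneg (mul_nonneg (h.cutoff_nonneg x) (h.deriv_nonneg (mollify ρ (w r) x)))
      (sq_nonneg (mollify ρ (v r) x))
    linarith

end Mollified

section Renormalized

variable {τ : ℝ} {w v : ℝ → L2R} {H : ℝ → ℝ → ℝ} {χ η β : ℝ → ℝ} {R s t : ℝ}

theorem IsRenormalization.tendsto_integral_mollify (h : IsRenormalization χ η β R) {z : ℝ → ℝ}
    (hz : LocallyIntegrable z) :
    Tendsto (fun n => ∫ x, χ x * η (mollify (shrinkingBump n) z x)) atTop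
      (𝓝 (∫ x, χ x * η (z x))) := by
  obtain ⟨C, hC⟩ := h.exists_bounds
  have hJ : ∀ n, Continuous (mollify (shrinkingBump n) z) := fun n => continuous_mollify hz
  have hχ := h.contDiff_cutoff.continuous
  have hβ := h.contDiff.continuous
  have hmeas : AEStronglyMeasurable fun x => χ x * β (z x) :=
    hχ.aestronglyMeasurable.mul (hβ.comp_aestronglyMeasurable hz.aestronglyMeasurable)
  have hmeas' : ∀ n, Continuous fun x => χ x * β (mollify (shrinkingBump n) z x) := fun n =>
    hχ.mul (hβ.comp (hJ n))
  have h0 : ∀ y : ℝ → ℝ, ∀ x, R < |x| → χ x * β (y x) = 0 := fun y x hx => by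
    rw [h.cutoff_eq_zero x hx, zero_mul]
  have h1 : ∀ y : ℝ → ℝ, ∀ x, R + 1 < |x| → χ x * β (y x) = 0 := fun y x hx =>
    h0 y x (by linarith)
  have hzR : IntegrableOn z (Icc (-(R + 1)) (R + 1)) := hz.integrableOn_isCompact isCompact_Icc
  have hint : Integrable fun x => χ x * β (z x) := by
    have := integrable_mul_of_eq_zero (H := fun _ => 1) (integrableOn_const (by simp)) hmeas
      (fun x => (hC x _).1) (h0 z)
    simpa using this
  -- convexity bounds the difference from both sides by pairings of `z` with bounded functions
  have hup : ∀ n, (∫ x, χ x * η (mollify (shrinkingBump n) z x)) - ∫ x, χ x * η (z x)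
      ≤ (∫ x, z x * mollify (shrinkingBump n)
          (fun y => χ y * β (mollify (shrinkingBump n) z y)) x)
        - ∫ x, z x * (χ x * β (mollify (shrinkingBump n) z x)) := fun n => by
    have hc := hasCompactSupport_of_eq_zero (h0 (mollify (shrinkingBump n) z))
    rw [← integral_mollify_mul hz ((hmeas' n).integrable_of_hasCompactSupport hc) hc]
    exact h.integral_sub_le (hJ n).locallyIntegrable hz
  have hlow : ∀ n, (∫ x, χ x * η (z x)) - (∫ x, χ x * η (mollify (shrinkingBump n) z x))
      ≤ (∫ x, z x * (χ x * β (z x)))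
        - ∫ x, z x * mollify (shrinkingBump n) (fun y => χ y * β (z y)) x := fun n => by
    rw [← integral_mollify_mul hz hint (hasCompactSupport_of_eq_zero (h0 z))]
    exact h.integral_sub_le hz (hJ n).locallyIntegrable
  have hlim₁ : Tendsto (fun n => ∫ x, z x * mollify (shrinkingBump n)
      (fun y => χ y * β (mollify (shrinkingBump n) z y)) x) atTop
      (𝓝 (∫ x, z x * (χ x * β (z x)))) :=
    tendsto_integral_mul_of_bounded hzR
      (Eventually.of_forall fun n => (continuous_mollify
        (hmeas' n).locallyIntegrable).aestronglyMeasurable)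
      (Eventually.of_forall fun n => abs_mollify_le (hmeas' n).aestronglyMeasurable
        fun x => (hC x _).1)
      (Eventually.of_forall fun n x => mollify_eq_zero (rOut_shrinkingBump_le_one n) (h0 _))
      (h1 z) (ae_tendsto_mollify_comp_mollify hz hχ hβ)
  have hlim₂ : Tendsto (fun n => ∫ x, z x * (χ x * β (mollify (shrinkingBump n) z x))) atTop
      (𝓝 (∫ x, z x * (χ x * β (z x)))) := by
    refine tendsto_integral_mul_of_bounded hzR
      (Eventually.of_forall fun n => (hmeas' n).aestronglyMeasurable)
      (Eventually.of_forall fun n x => (hC x _).1) (Eventually.of_forall fun n => h1 _) (h1 z) ?_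
    filter_upwards [ae_tendsto_mollify hz] with x hx
    exact ((hβ.tendsto _).comp hx).const_mul _
  have hlim₃ : Tendsto (fun n => ∫ x, z x * mollify (shrinkingBump n)
      (fun y => χ y * β (z y)) x) atTop (𝓝 (∫ x, z x * (χ x * β (z x)))) :=
    tendsto_integral_mul_of_bounded hzR
      (Eventually.of_forall fun n => (continuous_mollify
        hint.locallyIntegrable).aestronglyMeasurable)
      (Eventually.of_forall fun n => abs_mollify_le hmeas fun x => (hC x _).1)
      (Eventually.of_forall fun n x => mollify_eq_zero (rOut_shrinkingBump_le_one n) (h0 _))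
      (h1 z) (ae_tendsto_mollify hint.locallyIntegrable)
  have hU := hlim₁.sub hlim₂
  have hL := (tendsto_const_nhds (x := ∫ x, z x * (χ x * β (z x)))).sub hlim₃
  rw [sub_self] at hU hL
  have := tendsto_of_tendsto_of_tendsto_of_le_of_le (by simpa using hL.neg) hU
    (fun n => by simpa using neg_le_neg (hlow n)) hup
  simpa using this.add_const (∫ x, χ x * η (z x))

/-- The renormalised inequality: formally, `w_t = v_x + H` is multiplied by `χ β(w)` and the
nonnegative term `χ β'(w) v²` is dropped. -/
theorem IsWeakEvolution.renormalized_inequality (hw : IsWeakEvolution τ w v H)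
    (h : IsRenormalization χ η β R) (hs : τ ≤ s) (hst : s ≤ t) :
    IntervalIntegrable (fun r => (∫ x, H r x * (χ x * β (w r x)))
      - ∫ x, v r x * (deriv χ x * β (w r x))) volume s t ∧
    (∫ x, χ x * η (w t x)) - ∫ x, χ x * η (w s x)
      ≤ ∫ r in s..t, ((∫ x, H r x * (χ x * β (w r x)))
        - ∫ x, v r x * (deriv χ x * β (w r x))) := by
  obtain ⟨C, hC⟩ := h.exists_bounds
  have hχ := h.contDiff_cutoff.continuous
  have hχ' := h.contDiff_cutoff.continuous_deriv le_rfl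
  have hβ := h.contDiff.continuous
  have hloc : ∀ r, LocallyIntegrable (w r) := fun r => locallyIntegrable_Lp (w r)
  have hJ : ∀ n r, Continuous (mollify (shrinkingBump n) (w r)) := fun n r =>
    continuous_mollify (hloc r)
  have h0 : ∀ y : ℝ → ℝ, ∀ x, R < |x| → χ x * β (y x) = 0 := fun y x hx => by
    rw [h.cutoff_eq_zero x hx, zero_mul]
  have h0' : ∀ y : ℝ → ℝ, ∀ x, R < |x| → deriv χ x * β (y x) = 0 := fun y x hx => by
    rw [deriv_eq_zero_of_eq_zero h.cutoff_eq_zero hx, zero_mul]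
  let a : ℕ → ℝ → ℝ := fun n r =>
    (∫ x, H r x * mollify (shrinkingBump n)
        (fun y => χ y * β (mollify (shrinkingBump n) (w r) y)) x)
      - ∫ x, v r x * mollify (shrinkingBump n)
        (fun y => deriv χ y * β (mollify (shrinkingBump n) (w r) y)) x
  have hineq := fun n =>
    hw.mollified_inequality h (rOut_shrinkingBump_le_one n) hs hst
  have hsub : Ioc s t ⊆ Icc τ t := fun r hr => ⟨hs.trans hr.1.le, hr.2⟩
  have hle := Measure.restrict_mono_set volume hsub
  obtain ⟨m₁, hm₁, hb₁⟩ := hw.source.bound t (R + 1)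
  obtain ⟨m₂, hm₂, hb₂⟩ := hw.memL2.isSource.bound t (R + 1)
  have hm : IntegrableOn (fun r => C * m₁ r + C * m₂ r) (Ioc s t) :=
    ((hm₁.mono_set hsub).const_mul C).add ((hm₂.mono_set hsub).const_mul C)
  have hbound : ∀ n, ∀ᵐ r ∂(volume.restrict (Ioc s t)), ‖a n r‖ ≤ C * m₁ r + C * m₂ r := by
    intro n
    filter_upwards [ae_mono hle hb₁, ae_mono hle hb₂] with r h1 h2
    refine (abs_sub _ _).trans (add_le_add ?_ ?_)
    · exact abs_integral_mul_le h1.1 h1.2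
        (abs_mollify_le (hχ.mul (hβ.comp (hJ n r))).aestronglyMeasurable fun x => (hC x _).1)
        (fun x => mollify_eq_zero (rOut_shrinkingBump_le_one n) (h0 _))
    · exact abs_integral_mul_le h2.1 h2.2
        (abs_mollify_le (hχ'.mul (hβ.comp (hJ n r))).aestronglyMeasurable fun x => (hC x _).2)
        (fun x => mollify_eq_zero (rOut_shrinkingBump_le_one n) (h0' _))
  have hlim : ∀ᵐ r ∂(volume.restrict (Ioc s t)), Tendsto (fun n => a n r) atTop
      (𝓝 ((∫ x, H r x * (χ x * β (w r x))) - ∫ x, v r x * (deriv χ x * β (w r x)))) := by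
    filter_upwards [ae_mono hle hb₁, ae_mono hle hb₂] with r h1 h2
    refine Tendsto.sub ?_ ?_
    · exact tendsto_integral_mul_of_bounded h1.1
        (Eventually.of_forall fun n => (continuous_mollify
          (hχ.mul (hβ.comp (hJ n r))).locallyIntegrable).aestronglyMeasurable)
        (Eventually.of_forall fun n =>
          abs_mollify_le (hχ.mul (hβ.comp (hJ n r))).aestronglyMeasurable fun x => (hC x _).1)
        (Eventually.of_forall fun n x => mollify_eq_zero (rOut_shrinkingBump_le_one n) (h0 _))
        (fun x hx => h0 _ x (by linarith)) (ae_tendsto_mollify_comp_mollify (hloc r) hχ hβ)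
    · exact tendsto_integral_mul_of_bounded h2.1
        (Eventually.of_forall fun n => (continuous_mollify
          (hχ'.mul (hβ.comp (hJ n r))).locallyIntegrable).aestronglyMeasurable)
        (Eventually.of_forall fun n =>
          abs_mollify_le (hχ'.mul (hβ.comp (hJ n r))).aestronglyMeasurable fun x => (hC x _).2)
        (Eventually.of_forall fun n x => mollify_eq_zero (rOut_shrinkingBump_le_one n) (h0' _))
        (fun x hx => h0' _ x (by linarith)) (ae_tendsto_mollify_comp_mollify (hloc r) hχ' hβ)
  have hlim_int := tendsto_integral_of_dominated_convergence _ (fun n => (hineq n).1) hm hbound hlim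
  constructor
  · rw [intervalIntegrable_iff_integrableOn_Ioc_of_le hst]
    refine hm.mono' (aestronglyMeasurable_of_tendsto_ae atTop (fun n => (hineq n).1) hlim) ?_
    filter_upwards [hlim, ae_all_iff.2 hbound] with r hr hb
    exact le_of_tendsto' hr.norm hb
  · rw [intervalIntegral.integral_of_le hst]
    refine le_of_tendsto_of_tendsto' ((h.tendsto_integral_mollify (hloc t)).sub
      (h.tendsto_integral_mollify (hloc s))) hlim_int fun n => ?_
    have := (hineq n).2
    rwa [intervalIntegral.integral_of_le hst] at this

end Renormalized

/-! ### Measurability along curves in `L²(ℝ)` -/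

section Measurability

theorem continuous_integral_comp {θ φ : ℝ → ℝ} {C : ℝ} (hθ : Continuous θ) (hC : ∀ r, |θ r| ≤ C)
    (hφ : Integrable φ) : Continuous fun w : L2R => ∫ x, θ (w x) * φ x := by
  refine continuous_iff_seqContinuous.2 fun u w hu => ?_
  refine tendsto_of_subseq_tendsto fun ns hns => ?_
  have hmeas : TendstoInMeasure volume (fun n => (u (ns n) : ℝ → ℝ)) atTop w :=
    tendstoInMeasure_of_tendsto_Lp (hu.comp hns)
  obtain ⟨ms, -, hms⟩ := hmeas.exists_seq_tendsto_ae
  refine ⟨ms, tendsto_integral_of_dominated_convergence (fun x => C * |φ x|) (fun n => ?_)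
    (hφ.abs.const_mul C) (fun n => ae_of_all _ fun x => ?_) ?_⟩
  · exact (hθ.comp_aestronglyMeasurable (Lp.aestronglyMeasurable _)).mul hφ.aestronglyMeasurable
  · rw [norm_mul]
    exact mul_le_mul_of_nonneg_right (hC _) (norm_nonneg _)
  · filter_upwards [hms] with x hx
    exact ((hθ.tendsto _).comp hx).mul_const _

/-- The truncation of a function at height `m`. -/
def truncation (θ : ℝ → ℝ) (m : ℕ) (r : ℝ) : ℝ := max (-(m : ℝ)) (min m (θ r))

theorem continuous_truncation {θ : ℝ → ℝ} (hθ : Continuous θ) (m : ℕ) :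
    Continuous (truncation θ m) :=
  continuous_const.max (continuous_const.min hθ)

theorem abs_truncation_le (θ : ℝ → ℝ) (m : ℕ) (r : ℝ) : |truncation θ m r| ≤ m := by
  have : (0 : ℝ) ≤ m := m.cast_nonneg
  exact abs_le.2 ⟨le_max_left _ _, max_le (by linarith) (min_le_left _ _)⟩

theorem abs_truncation_le_abs (θ : ℝ → ℝ) (m : ℕ) (r : ℝ) : |truncation θ m r| ≤ |θ r| := by
  have : (0 : ℝ) ≤ m := m.cast_nonneg
  unfold truncation
  rw [abs_le]
  constructor
  · refine le_max_of_le_right (le_min ?_ (neg_abs_le _))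
    linarith [abs_nonneg (θ r)]
  · refine max_le (by linarith [abs_nonneg (θ r)]) ((min_le_right _ _).trans (le_abs_self _))

theorem tendsto_truncation (θ : ℝ → ℝ) (r : ℝ) :
    Tendsto (fun m => truncation θ m r) atTop (𝓝 (θ r)) := by
  refine tendsto_const_nhds.congr' ?_
  filter_upwards [eventually_ge_atTop ⌈|θ r|⌉₊] with m hm
  have h := abs_le.1 ((Nat.le_ceil _).trans (Nat.cast_le.2 hm) : |θ r| ≤ m)
  rw [truncation, min_eq_right h.2, max_eq_right h.1]

/-- The truncations of `θ` give continuous functionals on `L²(ℝ)`, so no joint measurability of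
`u r x` is needed. -/
theorem aestronglyMeasurable_integral_comp {μ : Measure ℝ} {u : ℝ → L2R}
    (hu : AEStronglyMeasurable u μ) {θ φ : ℝ → ℝ} (hθ : Continuous θ) (hφ : Integrable φ)
    (hint : ∀ᵐ r ∂μ, Integrable fun x => θ (u r x) * φ x) :
    AEStronglyMeasurable (fun r => ∫ x, θ (u r x) * φ x) μ := by
  refine aestronglyMeasurable_of_tendsto_ae atTop
    (f := fun (m : ℕ) r => ∫ x, truncation θ m (u r x) * φ x) (fun m => ?_) ?_
  · exact (continuous_integral_comp (continuous_truncation hθ m) (abs_truncation_le θ m)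
      hφ).comp_aestronglyMeasurable hu
  · filter_upwards [hint] with r hr
    refine tendsto_integral_of_dominated_convergence _ (fun m => ?_) hr.norm
      (fun m => ae_of_all _ fun x => ?_) (ae_of_all _ fun x => ?_)
    · exact ((continuous_truncation hθ m).comp_aestronglyMeasurable
        (Lp.aestronglyMeasurable _)).mul hφ.aestronglyMeasurable
    · rw [norm_mul, norm_mul]
      exact mul_le_mul_of_nonneg_right (abs_truncation_le_abs θ m _) (norm_nonneg _)
    · exact (tendsto_truncation θ _).mul_const _

end Measurability

/-! ### The energy inequality -/

section Energy

/-- A convex function that behaves like `r² / 2` near `0` and has linear growth. -/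
noncomputable def regSq (δ r : ℝ) : ℝ := r ^ 2 / (1 + √(1 + δ * r ^ 2))

/-- The derivative of `regSq δ`. -/
noncomputable def regId (δ r : ℝ) : ℝ := r * (√(1 + δ * r ^ 2))⁻¹

/-- The smooth cutoff equal to `1` on `[-(n + 1), n + 1]` and to `0` off `[-2(n + 1), 2(n + 1)]`. -/
noncomputable def cutoff (n : ℕ) (x : ℝ) : ℝ :=
  (⟨1, 2, one_pos, one_lt_two⟩ : ContDiffBump (0 : ℝ)) (x / (n + 1))

variable {δ : ℝ}

theorem one_le_sqrt (hδ : 0 ≤ δ) (r : ℝ) : 1 ≤ √(1 + δ * r ^ 2) :=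
  Real.one_le_sqrt.2 (by nlinarith [mul_nonneg hδ (sq_nonneg r)])

theorem regSq_nonneg (hδ : 0 ≤ δ) (r : ℝ) : 0 ≤ regSq δ r := by
  have := one_le_sqrt hδ r
  unfold regSq; positivity

theorem regSq_le (hδ : 0 ≤ δ) (r : ℝ) : regSq δ r ≤ r ^ 2 := by
  have := one_le_sqrt hδ r
  exact div_le_self (sq_nonneg r) (by linarith)

theorem continuous_regSq (hδ : 0 ≤ δ) : Continuous (regSq δ) := by
  unfold regSq
  refine Continuous.div (by fun_prop) (by fun_prop) fun r => ?_
  have := one_le_sqrt hδ r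
  positivity

theorem abs_regId_le (hδ : 0 ≤ δ) (r : ℝ) : |regId δ r| ≤ |r| := by
  have := one_le_sqrt hδ r
  rw [regId, abs_mul, abs_of_nonneg (by positivity : 0 ≤ (√(1 + δ * r ^ 2))⁻¹)]
  exact mul_le_of_le_one_right (abs_nonneg r) (inv_le_one_of_one_le₀ this)

theorem contDiff_regId (hδ : 0 ≤ δ) : ContDiff ℝ 1 (regId δ) := by
  have h : ∀ r : ℝ, 1 + δ * r ^ 2 ≠ 0 := fun r => by positivity
  have h' : ∀ r : ℝ, √(1 + δ * r ^ 2) ≠ 0 := fun r => by positivity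
  unfold regId
  exact contDiff_id.mul (ContDiff.inv (ContDiff.sqrt (by fun_prop) h) h')

theorem hasDerivAt_sqrt_one_add (hδ : 0 ≤ δ) (r : ℝ) :
    HasDerivAt (fun r => √(1 + δ * r ^ 2)) (δ * r / √(1 + δ * r ^ 2)) r := by
  have h : (1 + δ * r ^ 2) ≠ 0 := by positivity
  have h1 : HasDerivAt (fun r : ℝ => 1 + δ * r ^ 2) (δ * (2 * r)) r := by
    simpa using (((hasDerivAt_id r).pow 2).const_mul δ).const_add 1
  convert h1.sqrt h using 1
  field_simp

theorem hasDerivAt_regSq (hδ : 0 ≤ δ) (r : ℝ) : HasDerivAt (regSq δ) (regId δ r) r := by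
  have h1 := one_le_sqrt hδ r
  have hne : 1 + √(1 + δ * r ^ 2) ≠ 0 := by positivity
  have hsq : √(1 + δ * r ^ 2) ^ 2 = 1 + δ * r ^ 2 := Real.sq_sqrt (by positivity)
  refine (((hasDerivAt_id r).pow 2).div ((hasDerivAt_sqrt_one_add hδ r).const_add 1)
    hne).congr_deriv ?_
  simp only [regId, id, Pi.pow_apply]
  set S := √(1 + δ * r ^ 2)
  have hS : S ≠ 0 := by positivity
  field_simp
  linear_combination r * hsq

theorem deriv_regId_nonneg (hδ : 0 ≤ δ) (r : ℝ) : 0 ≤ deriv (regId δ) r := by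
  have h1 := one_le_sqrt hδ r
  have hsq : √(1 + δ * r ^ 2) ^ 2 = 1 + δ * r ^ 2 := Real.sq_sqrt (by positivity)
  have hS : √(1 + δ * r ^ 2) ≠ 0 := by positivity
  have h := (hasDerivAt_id r).mul ((hasDerivAt_sqrt_one_add hδ r).inv hS)
  have h' : deriv (regId δ) r = (√(1 + δ * r ^ 2) ^ 3)⁻¹ := by
    refine (h.congr_deriv ?_).deriv
    simp only [id, Pi.inv_apply]
    set S := √(1 + δ * r ^ 2)
    field_simp
    linear_combination hsq
  rw [h']
  positivity

theorem regId_bounded (hδ : 0 < δ) (r : ℝ) : |regId δ r| ≤ (√δ)⁻¹ := by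
  have h1 := one_le_sqrt hδ.le r
  have h2 : √δ * |r| ≤ √(1 + δ * r ^ 2) := by
    rw [← Real.sqrt_sq_eq_abs, ← Real.sqrt_mul hδ.le]
    exact Real.sqrt_le_sqrt (by linarith)
  have h3 := Real.sqrt_pos.2 hδ
  rw [regId, abs_mul, abs_of_nonneg (by positivity : 0 ≤ (√(1 + δ * r ^ 2))⁻¹), ← div_eq_mul_inv,
    div_le_iff₀ (by linarith), inv_mul_eq_div, le_div_iff₀ h3]
  linarith

theorem contDiff_cutoff (n : ℕ) : ContDiff ℝ 1 (cutoff n) :=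
  (ContDiffBump.contDiff _).comp (contDiff_id.div_const _)

theorem cutoff_nonneg (n : ℕ) (x : ℝ) : 0 ≤ cutoff n x := ContDiffBump.nonneg _

theorem cutoff_le_one (n : ℕ) (x : ℝ) : cutoff n x ≤ 1 := ContDiffBump.le_one _

theorem cutoff_eq_zero (n : ℕ) {x : ℝ} (hx : 2 * (n + 1) < |x|) : cutoff n x = 0 := by
  refine ContDiffBump.zero_of_le_dist _ ?_
  have : (0 : ℝ) < n + 1 := by positivity
  rw [dist_zero_right, Real.norm_eq_abs, abs_div, abs_of_pos this, le_div_iff₀ this]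
  exact hx.le

theorem tendsto_cutoff (x : ℝ) : Tendsto (fun n => cutoff n x) atTop (𝓝 1) := by
  have h : Tendsto (fun n : ℕ => x / (n + 1)) atTop (𝓝 0) := by
    have := (tendsto_one_div_add_atTop_nhds_zero_nat (𝕜 := ℝ)).const_mul x
    simpa [div_eq_mul_inv] using this
  have hone := (ContDiffBump.eventuallyEq_one
    (⟨1, 2, one_pos, one_lt_two⟩ : ContDiffBump (0 : ℝ)))
  refine tendsto_const_nhds.congr' ?_
  filter_upwards [h.eventually hone] with n hn
  exact hn.symm

theorem exists_abs_deriv_cutoff_le : ∃ C, ∀ n x, |deriv (cutoff n) x| ≤ C / (n + 1) := by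
  let B : ContDiffBump (0 : ℝ) := ⟨1, 2, one_pos, one_lt_two⟩
  have hB : ContDiff ℝ 1 B := B.contDiff
  obtain ⟨C, hC⟩ := (hB.continuous_deriv le_rfl).bounded_above_of_compact_support
    B.hasCompactSupport.deriv
  refine ⟨C, fun n x => ?_⟩
  have hn : (0 : ℝ) < n + 1 := by positivity
  have h : HasDerivAt (cutoff n) (deriv B (x / (n + 1)) * (1 / (n + 1))) x :=
    ((hB.differentiable one_ne_zero _).hasDerivAt).comp x ((hasDerivAt_id x).div_const _)
  rw [h.deriv, abs_mul, abs_of_pos (by positivity : 0 < 1 / ((n : ℝ) + 1)), mul_one_div]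
  exact div_le_div_of_nonneg_right (hC _) hn.le

theorem isRenormalization_cutoff (n : ℕ) (hδ : 0 < δ) :
    IsRenormalization (cutoff n) (regSq δ) (regId δ) (2 * (n + 1)) where
  contDiff_cutoff := contDiff_cutoff n
  cutoff_nonneg := cutoff_nonneg n
  cutoff_eq_zero _ := cutoff_eq_zero n
  hasDerivAt := hasDerivAt_regSq hδ.le
  contDiff := contDiff_regId hδ.le
  deriv_nonneg := deriv_regId_nonneg hδ.le
  bounded := ⟨_, regId_bounded hδ⟩

theorem abs_integral_mul_le_norm (h w : L2R) {g : ℝ → ℝ} {C : ℝ} (hg : AEStronglyMeasurable g)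
    (hC : ∀ x, |g x| ≤ C * |w x|) :
    Integrable (fun x => h x * g x) ∧ |∫ x, h x * g x| ≤ C * (‖h‖ * ‖w‖) := by
  have hmem : MemLp g 2 volume := (Lp.memLp w).of_le_mul hg (ae_of_all _ hC)
  refine ⟨(Lp.memLp h).integrable_mul hmem, ?_⟩
  rw [integral_mul_eq_inner hmem]
  have hn : ‖hmem.toLp g‖ ≤ C * ‖w‖ := by
    refine Lp.norm_le_mul_norm_of_ae_le_mul ?_
    filter_upwards [hmem.coeFn_toLp] with x hx
    rw [hx]
    exact hC x
  calc |inner ℝ h (hmem.toLp g)| ≤ ‖h‖ * ‖hmem.toLp g‖ := abs_real_inner_le_norm _ _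
    _ ≤ ‖h‖ * (C * ‖w‖) := by gcongr
    _ = _ := by ring

theorem MemL2Loc.integrableOn_norm_mul {τ : ℝ} {h w : ℝ → L2R} (hh : MemL2Loc τ h)
    (hw : MemL2Loc τ w) (T : ℝ) : IntegrableOn (fun r => ‖h r‖ * ‖w r‖) (Icc τ T) :=
  (hh T).norm.integrable_mul (hw T).norm

variable {τ lam κ : ℝ} {w v h : ℝ → L2R} {F : ℝ → ℝ → ℝ} {s t : ℝ}

/-- The regularised energy `∫ cutoff n · regSq (1 / (n + 1)) ∘ z` tends to `‖z‖² / 2`. -/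
theorem tendsto_integral_cutoff_regSq (z : L2R) :
    Tendsto (fun n : ℕ => ∫ x, cutoff n x * regSq (1 / ((n : ℝ) + 1)) (z x)) atTop
      (𝓝 (‖z‖ ^ 2 / 2)) := by
  have hδ : ∀ n : ℕ, 0 < 1 / ((n : ℝ) + 1) := fun n => by positivity
  rw [norm_sq_eq_integral, ← integral_div]
  refine tendsto_integral_of_dominated_convergence (fun x => z x ^ 2) (fun n => ?_)
    (Lp.memLp z).integrable_sq (fun n => ae_of_all _ fun x => ?_) (ae_of_all _ fun x => ?_)
  · exact (contDiff_cutoff n).continuous.aestronglyMeasurable.mul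
      ((continuous_regSq (hδ n).le).comp_aestronglyMeasurable (Lp.aestronglyMeasurable z))
  · rw [norm_mul, Real.norm_eq_abs, Real.norm_eq_abs, abs_of_nonneg (cutoff_nonneg n x),
      abs_of_nonneg (regSq_nonneg (hδ n).le _)]
    exact (mul_le_of_le_one_left (regSq_nonneg (hδ n).le _) (cutoff_le_one n x)).trans
      (regSq_le (hδ n).le _)
  · have h0 := (tendsto_one_div_add_atTop_nhds_zero_nat (𝕜 := ℝ))
    have hc : ContinuousAt (fun d => regSq d (z x)) 0 := by
      unfold regSq
      refine ContinuousAt.div (by fun_prop) (by fun_prop) ?_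
      positivity
    have h1 := (tendsto_cutoff x).mul (hc.tendsto.comp h0)
    have h2 : regSq 0 (z x) = z x ^ 2 / 2 := by simp [regSq]; norm_num
    simpa [h2] using h1

theorem tendsto_integral_mul_cutoff_regId (z : L2R) :
    Tendsto (fun n : ℕ => ∫ x, (z x * regId (1 / ((n : ℝ) + 1)) (z x)) * cutoff n x) atTop
      (𝓝 (‖z‖ ^ 2)) := by
  have hδ : ∀ n : ℕ, 0 < 1 / ((n : ℝ) + 1) := fun n => by positivity
  rw [norm_sq_eq_integral]
  refine tendsto_integral_of_dominated_convergence (fun x => z x ^ 2) (fun n => ?_)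
    (Lp.memLp z).integrable_sq (fun n => ae_of_all _ fun x => ?_) (ae_of_all _ fun x => ?_)
  · exact ((Lp.aestronglyMeasurable z).mul
      ((contDiff_regId (hδ n).le).continuous.comp_aestronglyMeasurable
        (Lp.aestronglyMeasurable z))).mul (contDiff_cutoff n).continuous.aestronglyMeasurable
  · rw [norm_mul, norm_mul, Real.norm_eq_abs, Real.norm_eq_abs, Real.norm_eq_abs,
      abs_of_nonneg (cutoff_nonneg n x), ← sq_abs, sq]
    refine (mul_le_of_le_one_right (by positivity) (cutoff_le_one n x)).trans ?_
    exact mul_le_mul_of_nonneg_left (abs_regId_le (hδ n).le _) (abs_nonneg _)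
  · have h0 := (tendsto_one_div_add_atTop_nhds_zero_nat (𝕜 := ℝ))
    have hc : ContinuousAt (fun d => regId d (z x)) 0 := by
      unfold regId
      refine ContinuousAt.mul continuousAt_const (ContinuousAt.inv₀ (by fun_prop) ?_)
      simp
    have h1 := ((hc.tendsto.comp h0).const_mul (z x)).mul (tendsto_cutoff x)
    have h2 : regId 0 (z x) = z x := by simp [regId]
    simpa [h2, sq] using h1

/-- The energy inequality for `w_t = w_xx - lam w - F + h` when `F w ≥ -κ w²`. -/
theorem IsWeakEvolution.energy_inequality (hh : MemL2Loc τ h) (hF : IsSource τ F)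
    (hw : IsWeakEvolution τ w v fun r x => h r x - lam * w r x - F r x)
    (hFw : ∀ᵐ r ∂(volume.restrict (Ici τ)), ∀ᵐ x, -κ * w r x ^ 2 ≤ F r x * w r x)
    (hs : τ ≤ s) (hst : s ≤ t) :
    ‖w t‖ ^ 2 - ‖w s‖ ^ 2 ≤ 2 * ∫ r in s..t, (‖h r‖ * ‖w r‖ + (κ - lam) * ‖w r‖ ^ 2) := by
  obtain ⟨C, hC⟩ := exists_abs_deriv_cutoff_le
  have hδ : ∀ n : ℕ, 0 < 1 / ((n : ℝ) + 1) := fun n => by positivity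
  have hsub : Ioc s t ⊆ Icc τ t := fun r hr => ⟨hs.trans hr.1.le, hr.2⟩
  have hsub' : Ioc s t ⊆ Ici τ := fun r hr => hs.trans hr.1.le
  have hle := Measure.restrict_mono_set volume hsub
  have hwL := hw.continuousOn.memL2Loc
  have i₁ : IntegrableOn (fun r => ‖h r‖ * ‖w r‖) (Ioc s t) :=
    (hh.integrableOn_norm_mul hwL t).mono_set hsub
  have i₂ : IntegrableOn (fun r => ‖v r‖ * ‖w r‖) (Ioc s t) :=
    (hw.memL2.integrableOn_norm_mul hwL t).mono_set hsub
  have i₃ : IntegrableOn (fun r => ‖w r‖ ^ 2) (Ioc s t) :=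
    (hwL.integrableOn_norm_sq t).mono_set hsub
  let q : ℕ → ℝ → ℝ := fun n r =>
    ∫ x, (w r x * regId (1 / ((n : ℝ) + 1)) (w r x)) * cutoff n x
  have hmul : ∀ (n : ℕ) (z : L2R), AEStronglyMeasurable
      (fun x => cutoff n x * regId (1 / ((n : ℝ) + 1)) (z x)) := fun n z =>
    (contDiff_cutoff n).continuous.aestronglyMeasurable.mul
      ((contDiff_regId (hδ n).le).continuous.comp_aestronglyMeasurable (Lp.aestronglyMeasurable z))
  have hmul_le : ∀ (n : ℕ) (z : L2R) x,
      |cutoff n x * regId (1 / ((n : ℝ) + 1)) (z x)| ≤ 1 * |z x| := fun n z x => by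
    rw [abs_mul, abs_of_nonneg (cutoff_nonneg n x)]
    exact mul_le_mul (cutoff_le_one n x) (abs_regId_le (hδ n).le _) (abs_nonneg _) zero_le_one
  have hq_eq : ∀ n r, q n r = ∫ x, w r x * (cutoff n x * regId (1 / ((n : ℝ) + 1)) (w r x)) :=
    fun n r => integral_congr_ae (ae_of_all _ fun x => by ring)
  have hq_le : ∀ n r, ‖q n r‖ ≤ ‖w r‖ ^ 2 := fun n r => by
    rw [hq_eq, sq, ← one_mul (‖w r‖ * ‖w r‖)]
    exact (abs_integral_mul_le_norm (w r) (w r) (hmul n _) (hmul_le n _)).2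
  have hq_meas : ∀ n, AEStronglyMeasurable (q n) (volume.restrict (Ioc s t)) := fun n => by
    refine aestronglyMeasurable_integral_comp
      (θ := fun a => a * regId (1 / ((n : ℝ) + 1)) a) (φ := cutoff n)
      ((hwL t).aestronglyMeasurable.mono_measure hle)
      (continuous_id.mul (contDiff_regId (hδ n).le).continuous)
      ((contDiff_cutoff n).continuous.integrable_of_hasCompactSupport
        (hasCompactSupport_of_eq_zero fun x => cutoff_eq_zero n)) (ae_of_all _ fun r => ?_)
    refine (abs_integral_mul_le_norm (w r) (w r) (hmul n _) (hmul_le n _)).1.congr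
      (ae_of_all _ fun x => by ring)
  have i₄ : ∀ n, IntegrableOn (q n) (Ioc s t) := fun n =>
    i₃.mono' (hq_meas n) (ae_of_all _ (hq_le n))
  have hineq : ∀ n : ℕ, (∫ x, cutoff n x * regSq (1 / ((n : ℝ) + 1)) (w t x))
      - ∫ x, cutoff n x * regSq (1 / ((n : ℝ) + 1)) (w s x)
      ≤ (∫ r in Ioc s t, ‖h r‖ * ‖w r‖) + (κ - lam) * (∫ r in Ioc s t, q n r)
        + C / (n + 1) * ∫ r in Ioc s t, ‖v r‖ * ‖w r‖ := by
    intro n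
    have hren := isRenormalization_cutoff n (hδ n)
    obtain ⟨hint, hle'⟩ := hw.renormalized_inequality hren hs hst
    refine hle'.trans ?_
    rw [intervalIntegrable_iff_integrableOn_Ioc_of_le hst] at hint
    have i₅ : IntegrableOn (fun r => ‖h r‖ * ‖w r‖ + (κ - lam) * q n r) (Ioc s t) :=
      i₁.add ((i₄ n).const_mul _)
    rw [intervalIntegral.integral_of_le hst, ← integral_const_mul, ← integral_const_mul,
      ← integral_add i₁ ((i₄ n).const_mul _),
      ← integral_add i₅ (i₂.const_mul _)]
    refine integral_mono_ae hint (i₅.add (i₂.const_mul _)) ?_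
    obtain ⟨Cn, hCn⟩ := hren.exists_bounds
    filter_upwards [ae_mono (Measure.restrict_mono_set volume hsub') hFw,
      ae_mono hle (hF.ae_integrable t (2 * ((n : ℝ) + 1)))] with r hr hFr
    set ψ : ℝ → ℝ := fun x => cutoff n x * regId (1 / ((n : ℝ) + 1)) (w r x) with hψ
    have e₁ := abs_integral_mul_le_norm (h r) (w r) (hmul n _) (hmul_le n _)
    have e₂ := abs_integral_mul_le_norm (w r) (w r) (hmul n _) (hmul_le n _)
    have e₃ := abs_integral_mul_le_norm (v r) (w r)
      (g := fun x => deriv (cutoff n) x * regId (1 / ((n : ℝ) + 1)) (w r x)) (C := C / (n + 1))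
      (((contDiff_cutoff n).continuous_deriv le_rfl).aestronglyMeasurable.mul
        ((contDiff_regId (hδ n).le).continuous.comp_aestronglyMeasurable
          (Lp.aestronglyMeasurable (w r)))) (fun x => by
        rw [abs_mul]
        exact mul_le_mul (hC n x) (abs_regId_le (hδ n).le _) (abs_nonneg _)
          ((abs_nonneg _).trans (hC n x)))
    have e₄ : Integrable fun x => F r x * ψ x :=
      integrable_mul_of_eq_zero hFr (hmul n _) (fun x => (hCn x _).1) fun x hx => by
        rw [hψ]; simp only; rw [cutoff_eq_zero n hx, zero_mul]
    have e₅ : Integrable fun x => h r x * ψ x - lam * (w r x * ψ x) :=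
      e₁.1.sub (e₂.1.const_mul lam)
    have hsplit : ∫ x, (h r x - lam * w r x - F r x) * ψ x
        = (∫ x, h r x * ψ x) - lam * (∫ x, w r x * ψ x) - ∫ x, F r x * ψ x := by
      rw [← integral_const_mul, ← integral_sub e₁.1 (e₂.1.const_mul lam),
        ← integral_sub e₅ e₄]
      exact integral_congr_ae (ae_of_all _ fun x => by ring)
    have hFψ : -κ * (∫ x, w r x * ψ x) ≤ ∫ x, F r x * ψ x := by
      rw [← integral_const_mul]
      refine integral_mono_ae (e₂.1.const_mul _) e₄ ?_
      filter_upwards [hr] with x hx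
      -- `regId δ a` is a nonnegative multiple of `a`
      have hg : 0 ≤ cutoff n x * (√(1 + 1 / ((n : ℝ) + 1) * w r x ^ 2))⁻¹ :=
        mul_nonneg (cutoff_nonneg n x) (by positivity)
      have := mul_le_mul_of_nonneg_right hx hg
      simp only [hψ, regId]
      linarith
    have h1 := (abs_le.1 e₁.2).2
    have h3 := (abs_le.1 e₃.2).1
    rw [hsplit, hq_eq]
    linarith
  have hlimL := (tendsto_integral_cutoff_regSq (w t)).sub (tendsto_integral_cutoff_regSq (w s))
  have hlimq : Tendsto (fun n => ∫ r in Ioc s t, q n r) atTop (𝓝 (∫ r in Ioc s t, ‖w r‖ ^ 2)) :=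
    tendsto_integral_of_dominated_convergence _ hq_meas i₃ (fun n => ae_of_all _ (hq_le n))
      (ae_of_all _ fun r => tendsto_integral_mul_cutoff_regId (w r))
  have hlimC : Tendsto (fun n : ℕ => C / ((n : ℝ) + 1)) atTop (𝓝 0) := by
    simpa [div_eq_mul_inv] using
      (tendsto_one_div_add_atTop_nhds_zero_nat (𝕜 := ℝ)).const_mul C
  have hfinal := le_of_tendsto_of_tendsto' hlimL
    (((hlimq.const_mul (κ - lam)).const_add _).add (hlimC.mul_const _)) hineq
  rw [intervalIntegral.integral_of_le hst, integral_add i₁ (i₃.const_mul _), integral_const_mul]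
  linarith

end Energy

/-! ### Weak solutions -/

section WeakSolutions

variable {τ lam : ℝ} {f : ℝ → ℝ} {g u : ℝ → L2R} {u₀ : L2R}

theorem IsSource.congr {H G : ℝ → ℝ → ℝ} (hH : IsSource τ H) (h : ∀ r, H r =ᵐ[volume] G r) :
    IsSource τ G where
  measurable φ hφ T := (hH.measurable φ hφ T).congr (ae_of_all _ fun r =>
    integral_congr_ae ((h r).mono fun x hx => by simp only [hx]))
  bound T R := by
    obtain ⟨m, hm, hb⟩ := hH.bound T R
    refine ⟨m, hm, hb.mono fun r hr => ⟨hr.1.congr (ae_restrict_of_ae (h r)), ?_⟩⟩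
    refine le_trans (le_of_eq (integral_congr_ae ?_)) hr.2
    exact (ae_restrict_of_ae (h r)).mono fun x hx => by simp only [hx]

theorem IsWeakEvolution.congr {w v : ℝ → L2R} {H G : ℝ → ℝ → ℝ} (hw : IsWeakEvolution τ w v H)
    (h : ∀ r, H r =ᵐ[volume] G r) : IsWeakEvolution τ w v G where
  continuousOn := hw.continuousOn
  memL2 := hw.memL2
  weakDeriv := hw.weakDeriv
  source := hw.source.congr h
  equation φ hφ s t hs hst := by
    rw [hw.equation φ hφ s t hs hst]
    have : ∀ r, ∫ x, H r x * φ x = ∫ x, G r x * φ x := fun r =>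
      integral_congr_ae ((h r).mono fun x hx => by simp only [hx])
    simp only [this]

theorem integrable_Lp_mul (w : L2R) {φ : ℝ → ℝ} (hφ : IsTestFunction φ) :
    Integrable fun x => w x * φ x :=
  (Lp.memLp w).integrable_mul hφ.memLp

theorem integral_sub_mul (w₁ w₂ : L2R) {φ : ℝ → ℝ} (hφ : IsTestFunction φ) :
    ∫ x, (w₁ - w₂ : L2R) x * φ x = (∫ x, w₁ x * φ x) - ∫ x, w₂ x * φ x := by
  rw [← integral_sub (integrable_Lp_mul w₁ hφ) (integrable_Lp_mul w₂ hφ)]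
  refine integral_congr_ae ?_
  filter_upwards [Lp.coeFn_sub w₁ w₂] with x hx
  rw [hx, Pi.sub_apply, sub_mul]

theorem HasWeakDerivative.sub {w₁ v₁ w₂ v₂ : L2R} (h₁ : HasWeakDerivative w₁ v₁)
    (h₂ : HasWeakDerivative w₂ v₂) : HasWeakDerivative (w₁ - w₂) (v₁ - v₂) := by
  intro φ hφ
  rw [integral_sub_mul _ _ hφ, integral_sub_mul _ _ hφ.deriv, h₁ φ hφ, h₂ φ hφ]
  ring

theorem IsWeakEvolution.intervalIntegrable {w v : ℝ → L2R} {H : ℝ → ℝ → ℝ}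
    (hw : IsWeakEvolution τ w v H) {φ : ℝ → ℝ} (hφ : IsTestFunction φ) {s t : ℝ} (hs : τ ≤ s)
    (hst : s ≤ t) :
    IntervalIntegrable (fun r => (∫ x, H r x * φ x) - ∫ x, v r x * deriv φ x) volume s t := by
  rw [intervalIntegrable_iff_integrableOn_Icc_of_le hst]
  exact ((hw.source.integrableOn t hφ).sub (hw.memL2.isSource.integrableOn t hφ.deriv)).mono_set
    (Icc_subset_Icc_left hs)

theorem IsWeakEvolution.sub {w₁ v₁ w₂ v₂ : ℝ → L2R} {H₁ H₂ : ℝ → ℝ → ℝ}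
    (h₁ : IsWeakEvolution τ w₁ v₁ H₁) (h₂ : IsWeakEvolution τ w₂ v₂ H₂) :
    IsWeakEvolution τ (fun r => w₁ r - w₂ r) (fun r => v₁ r - v₂ r)
      (fun r x => H₁ r x - H₂ r x) where
  continuousOn := h₁.continuousOn.sub h₂.continuousOn
  memL2 T := (h₁.memL2 T).sub (h₂.memL2 T)
  weakDeriv := by
    filter_upwards [h₁.weakDeriv, h₂.weakDeriv] with r hr₁ hr₂ using hr₁.sub hr₂
  source := h₁.source.sub h₂.source
  equation φ hφ s t hs hst := by
    have e₁ := h₁.equation φ hφ s t hs hst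
    have e₂ := h₂.equation φ hφ s t hs hst
    rw [integral_sub_mul _ _ hφ, integral_sub_mul _ _ hφ, sub_sub_sub_comm, e₁, e₂,
      ← intervalIntegral.integral_sub (h₁.intervalIntegrable hφ hs hst)
        (h₂.intervalIntegrable hφ hs hst)]
    refine intervalIntegral.integral_congr_ae_restrict ?_
    have hsub : uIoc s t ⊆ Icc τ t := by
      rw [uIoc_of_le hst]
      exact fun r hr => ⟨hs.trans hr.1.le, hr.2⟩
    have hle := Measure.restrict_mono_set volume hsub
    filter_upwards [ae_mono hle (h₁.source.ae_integrable_mul t hφ),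
      ae_mono hle (h₂.source.ae_integrable_mul t hφ)] with r i₁ i₂
    simp only [sub_mul]
    rw [integral_sub_mul _ _ hφ.deriv, integral_sub i₁ i₂]
    ring

/-- The local `L¹` norm of `f(u r)` is measurable in `r`, without a jointly measurable representative
of `u`: the integrals of the truncations of `|f|` are continuous on `L²(ℝ)`. -/
theorem aemeasurable_lintegral_comp {μ : Measure ℝ} (hu : AEStronglyMeasurable u μ)
    (hf : Continuous f) (R : ℝ) :
    AEMeasurable (fun r => ∫⁻ x in Icc (-R) R, ‖f (u r x)‖ₑ) μ := by
  let θ : ℕ → ℝ → ℝ := fun m a => min (m : ℝ) |f a|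
  have hθ : ∀ m, Continuous (θ m) := fun m => continuous_const.min hf.abs
  have hθ0 : ∀ m a, 0 ≤ θ m a := fun m a => le_min m.cast_nonneg (abs_nonneg _)
  have hθm : ∀ m a, |θ m a| ≤ m := fun m a => by
    rw [abs_of_nonneg (hθ0 m a)]; exact min_le_left _ _
  have hφ : Integrable ((Icc (-R) R).indicator fun _ => (1 : ℝ)) :=
    (integrableOn_const (by simp)).integrable_indicator measurableSet_Icc
  have hmeas : ∀ (m : ℕ) (w : L2R), AEStronglyMeasurable (fun x => θ m (w x)) volume := fun m w =>
    (hθ m).comp_aestronglyMeasurable (Lp.aestronglyMeasurable w)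
  have key : ∀ (m : ℕ) (w : L2R), ∫⁻ x in Icc (-R) R, ENNReal.ofReal (θ m (w x))
      = ENNReal.ofReal (∫ x, θ m (w x) * (Icc (-R) R).indicator (fun _ => (1 : ℝ)) x) := by
    intro m w
    have h1 : ∫ x, θ m (w x) * (Icc (-R) R).indicator (fun _ => (1 : ℝ)) x
        = ∫ x in Icc (-R) R, θ m (w x) := by
      rw [← integral_indicator measurableSet_Icc]
      refine integral_congr_ae (ae_of_all _ fun x => ?_)
      by_cases hx : x ∈ Icc (-R) R <;> simp [hx]
    rw [h1, ofReal_integral_eq_lintegral_ofReal ?_ (ae_of_all _ fun x => hθ0 m _)]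
    exact Measure.integrableOn_of_bounded (M := m) (by simp) (hmeas m w)
      (ae_of_all _ fun x => hθm m _)
  refine aemeasurable_of_tendsto_metrizable_ae atTop
    (f := fun (m : ℕ) r => ∫⁻ x in Icc (-R) R, ENNReal.ofReal (θ m (u r x))) (fun m => ?_)
    (ae_of_all _ fun r => ?_)
  · simp only [key]
    exact ((continuous_integral_comp (hθ m) (hθm m) hφ).comp_aestronglyMeasurable
      hu).aemeasurable.ennreal_ofReal
  · refine lintegral_tendsto_of_tendsto_of_monotone
      (fun m => (hmeas m (u r)).aemeasurable.ennreal_ofReal.restrict)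
      (ae_of_all _ fun x m m' hm => ENNReal.ofReal_le_ofReal
        (min_le_min_right _ (Nat.cast_le.2 hm))) (ae_of_all _ fun x => ?_)
    rw [← ofReal_norm]
    refine tendsto_const_nhds.congr' ?_
    filter_upwards [eventually_ge_atTop ⌈|f (u r x)|⌉₊] with m hm
    have : |f (u r x)| ≤ m := (Nat.le_ceil _).trans (Nat.cast_le.2 hm)
    simp only [θ, min_eq_right this, Real.norm_eq_abs]

theorem IsWeakSolution.isSource (hf : Continuous f) (hu : IsWeakSolution lam f g τ u₀ u) :
    IsSource τ fun r x => f (u r x) := by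
  have hmeas : ∀ T, AEStronglyMeasurable u (volume.restrict (Icc τ T)) := fun T =>
    (hu.continuousOn.memL2Loc T).aestronglyMeasurable
  have hfin : ∀ T R, ∀ᵐ r ∂(volume.restrict (Icc τ T)),
      IntegrableOn (fun x => f (u r x)) (Icc (-R) R) := by
    intro T R
    filter_upwards [ae_lt_top' (aemeasurable_lintegral_comp (hmeas T) hf R)
      (hu.locallyIntegrable T R).ne] with r hr
    exact ⟨(hf.comp_aestronglyMeasurable (Lp.aestronglyMeasurable _)).restrict, hr⟩
  refine ⟨fun φ hφ T => ?_, fun T R => ?_⟩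
  · refine aestronglyMeasurable_integral_comp (hmeas T) hf
      (hφ.1.continuous.integrable_of_hasCompactSupport hφ.2) ?_
    obtain ⟨R, C, h0, hC⟩ := hφ.exists_bound
    filter_upwards [hfin T R] with r hr
    exact integrable_mul_of_eq_zero hr hφ.1.continuous.aestronglyMeasurable hC h0
  · refine ⟨fun r => (∫⁻ x in Icc (-R) R, ‖f (u r x)‖ₑ).toReal,
      integrable_toReal_of_lintegral_ne_top (aemeasurable_lintegral_comp (hmeas T) hf R)
        (hu.locallyIntegrable T R).ne, ?_⟩
    filter_upwards [hfin T R] with r hr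
    exact ⟨hr, (integral_norm_eq_lintegral_enorm hr.aestronglyMeasurable).le⟩

theorem IsWeakSolution.exists_isWeakEvolution (hf : Continuous f) (hg : MemL2Loc τ g)
    (hu : IsWeakSolution lam f g τ u₀ u) :
    ∃ v, IsWeakEvolution τ u v fun r x => g r x - lam * u r x - f (u r x) := by
  obtain ⟨v, hv, hweak, heq⟩ := hu.equation
  have hF := hu.isSource hf
  have hU := hu.continuousOn.memL2Loc.isSource
  refine ⟨v, hu.continuousOn, hv, hweak, (hg.isSource.sub (hU.const_mul lam)).sub hF,
    fun φ hφ s t hs hst => ?_⟩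
  let X : ℝ → ℝ := fun r => (∫ x, g r x * φ x) - (∫ x, v r x * deriv φ x)
    - lam * (∫ x, u r x * φ x) - ∫ x, f (u r x) * φ x
  have hX : ∀ T, IntegrableOn X (Icc τ T) := fun T =>
    (((hg.isSource.integrableOn T hφ).sub (hv.isSource.integrableOn T hφ.deriv)).sub
      ((hU.integrableOn T hφ).const_mul lam)).sub (hF.integrableOn T hφ)
  have hXi : ∀ T, τ ≤ T → IntervalIntegrable X volume τ T := fun T hT =>
    (intervalIntegrable_iff_integrableOn_Icc_of_le hT).2 (hX T)
  rw [heq φ hφ t (hs.trans hst), heq φ hφ s hs, add_sub_add_left_eq_sub,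
    intervalIntegral.integral_interval_sub_left (hXi t (hs.trans hst)) (hXi s hs)]
  refine intervalIntegral.integral_congr_ae_restrict ?_
  have hsub : uIoc s t ⊆ Icc τ t := by
    rw [uIoc_of_le hst]
    exact fun r hr => ⟨hs.trans hr.1.le, hr.2⟩
  filter_upwards [ae_mono (Measure.restrict_mono_set volume hsub)
    (hF.ae_integrable_mul t hφ)] with r hr
  have i₁ := integrable_Lp_mul (g r) hφ
  have i₂ := (integrable_Lp_mul (u r) hφ).const_mul lam
  have i₃ : Integrable fun x => g r x * φ x - lam * (u r x * φ x) := i₁.sub i₂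
  have hsplit : ∫ x, (g r x - lam * u r x - f (u r x)) * φ x
      = (∫ x, g r x * φ x) - lam * (∫ x, u r x * φ x) - ∫ x, f (u r x) * φ x := by
    rw [← integral_const_mul, ← integral_sub i₁ i₂, ← integral_sub i₃ hr]
    exact integral_congr_ae (ae_of_all _ fun x => by ring)
  rw [hsplit]
  ring

/-- Weak solutions of the autonomous equation may be translated in time. -/
theorem IsWeakSolution.shift {g₀ : L2R} (hu : IsWeakSolution lam f (fun _ => g₀) 0 u₀ u) (τ : ℝ) :
    IsWeakSolution lam f (fun _ => g₀) τ u₀ fun t => u (t - τ) where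
  continuousOn := hu.continuousOn.comp (continuous_id.sub continuous_const).continuousOn
    fun t ht => mem_Ici.2 (sub_nonneg.2 ht)
  initial := by simpa using hu.initial
  locallyIntegrable T R := by
    have h := (measurePreserving_sub_right (volume : Measure ℝ) τ).setLIntegral_comp_emb
      (measurableEmbedding_subRight τ) (fun t => ∫⁻ x in Icc (-R) R, ‖f (u t x)‖ₑ) (Icc τ T)
    rw [h]
    simpa using hu.locallyIntegrable (T - τ) R
  equation := by
    obtain ⟨v, hv, hweak, heq⟩ := hu.equation
    have hmp : ∀ {S S' : Set ℝ}, MeasurableSet S' → S = (fun t => t - τ) ⁻¹' S' →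
        MeasurePreserving (fun t : ℝ => t - τ) (volume.restrict S) (volume.restrict S') :=
      fun hS h => h ▸ (measurePreserving_sub_right (volume : Measure ℝ) τ).restrict_preimage hS
    refine ⟨fun t => v (t - τ), fun T => ?_, ?_, fun φ hφ t ht => ?_⟩
    · exact (hv (T - τ)).comp_measurePreserving (hmp measurableSet_Icc (by simp))
    · exact (hmp measurableSet_Ici (by simp)).quasiMeasurePreserving.ae hweak
    · rw [heq φ hφ (t - τ) (sub_nonneg.2 ht)]
      congr 1
      have := intervalIntegral.integral_comp_sub_right (a := τ) (b := t)
        (fun s => (∫ x, g₀ x * φ x) - (∫ x, v s x * deriv φ x)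
          - lam * (∫ x, u s x * φ x) - ∫ x, f (u s x) * φ x) τ
      rw [sub_self] at this
      exact this.symm

end WeakSolutions

/-! ### Estimates for weak solutions -/

section Estimates

variable {τ lam c : ℝ} {f : ℝ → ℝ} {g g₁ g₂ u u₁ u₂ : ℝ → L2R} {u₀ u₀₁ u₀₂ : L2R} {s t : ℝ}

theorem IsWeakSolution.energy_inequality (hf : Continuous f) (hf_sign : ∀ r, 0 ≤ f r * r)
    (hg : MemL2Loc τ g) (hu : IsWeakSolution lam f g τ u₀ u) (hs : τ ≤ s) (hst : s ≤ t) :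
    ‖u t‖ ^ 2 - ‖u s‖ ^ 2 ≤ 2 * ∫ r in s..t, (‖g r‖ * ‖u r‖ + (0 - lam) * ‖u r‖ ^ 2) := by
  obtain ⟨v, hv⟩ := hu.exists_isWeakEvolution hf hg
  refine hv.energy_inequality hg (hu.isSource hf) (ae_of_all _ fun r => ae_of_all _ fun x => ?_)
    hs hst
  simpa using hf_sign (u r x)

theorem IsWeakSolution.energy_inequality_sub (hf : Continuous f)
    (hf_mono : ∀ a b, -c * (a - b) ^ 2 ≤ (f a - f b) * (a - b))
    (hg₁ : MemL2Loc τ g₁) (hg₂ : MemL2Loc τ g₂) (hu₁ : IsWeakSolution lam f g₁ τ u₀₁ u₁)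
    (hu₂ : IsWeakSolution lam f g₂ τ u₀₂ u₂) (hs : τ ≤ s) (hst : s ≤ t) :
    ‖u₁ t - u₂ t‖ ^ 2 - ‖u₁ s - u₂ s‖ ^ 2 ≤ 2 * ∫ r in s..t,
      (‖g₁ r - g₂ r‖ * ‖u₁ r - u₂ r‖ + (c - lam) * ‖u₁ r - u₂ r‖ ^ 2) := by
  obtain ⟨v₁, hv₁⟩ := hu₁.exists_isWeakEvolution hf hg₁
  obtain ⟨v₂, hv₂⟩ := hu₂.exists_isWeakEvolution hf hg₂
  have hw : IsWeakEvolution τ (fun r => u₁ r - u₂ r) (fun r => v₁ r - v₂ r) fun r x =>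
      (g₁ r - g₂ r : L2R) x - lam * (u₁ r - u₂ r : L2R) x - (f (u₁ r x) - f (u₂ r x)) := by
    refine (hv₁.sub hv₂).congr fun r => ?_
    filter_upwards [Lp.coeFn_sub (g₁ r) (g₂ r), Lp.coeFn_sub (u₁ r) (u₂ r)] with x h1 h2
    rw [h1, h2, Pi.sub_apply, Pi.sub_apply]
    ring
  refine IsWeakEvolution.energy_inequality (h := fun r => g₁ r - g₂ r)
    (w := fun r => u₁ r - u₂ r) (F := fun r x => f (u₁ r x) - f (u₂ r x))
    (fun T => (hg₁ T).sub (hg₂ T)) ((hu₁.isSource hf).sub (hu₂.isSource hf)) hw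
    (ae_of_all _ fun r => ?_) hs hst
  filter_upwards [Lp.coeFn_sub (u₁ r) (u₂ r)] with x hx
  rw [hx, Pi.sub_apply]
  exact hf_mono _ _

theorem integral_norm_sq_le {h : ℝ → L2R} (hh : MemL2Loc τ h)
    (hfin : ∫⁻ r in Ici τ, ‖h r‖ₑ ^ 2 ≠ ∞) (hs : τ ≤ s) (hst : s ≤ t) :
    ∫ r in s..t, ‖h r‖ ^ 2 ≤ (∫⁻ r in Ici τ, ‖h r‖ₑ ^ 2).toReal := by
  have hsub : Ioc s t ⊆ Icc τ t := fun r hr => ⟨hs.trans hr.1.le, hr.2⟩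
  have hmeas := ((hh.integrableOn_norm_sq t).mono_set hsub).aestronglyMeasurable
  rw [intervalIntegral.integral_of_le hst,
    integral_eq_lintegral_of_nonneg_ae (ae_of_all _ fun r => sq_nonneg _) hmeas]
  refine ENNReal.toReal_mono hfin ?_
  calc ∫⁻ r in Ioc s t, ENNReal.ofReal (‖h r‖ ^ 2) = ∫⁻ r in Ioc s t, ‖h r‖ₑ ^ 2 := by
        simp only [ENNReal.ofReal_pow (norm_nonneg _), ofReal_norm]
    _ ≤ ∫⁻ r in Ici τ, ‖h r‖ₑ ^ 2 := lintegral_mono_set (hsub.trans Icc_subset_Ici_self)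

/-- Two weak solutions with the same initial value stay close if the forcings are close in
`L²([τ, ∞); L²(ℝ))`. -/
theorem IsWeakSolution.norm_sub_sq_le (hf : Continuous f) (hlam : 0 ≤ lam) (hc : 0 ≤ c)
    (hf_mono : ∀ a b, -c * (a - b) ^ 2 ≤ (f a - f b) * (a - b))
    (hg₁ : MemL2Loc τ g₁) (hg₂ : MemL2Loc τ g₂) (hu₁ : IsWeakSolution lam f g₁ τ u₀ u₁)
    (hu₂ : IsWeakSolution lam f g₂ τ u₀ u₂)
    (hfin : ∫⁻ r in Ici τ, ‖g₁ r - g₂ r‖ₑ ^ 2 ≠ ∞) (ht : τ ≤ t) :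
    ‖u₁ t - u₂ t‖ ^ 2 ≤ (∫⁻ r in Ici τ, ‖g₁ r - g₂ r‖ₑ ^ 2).toReal
      + (1 + 2 * c) * gronwallBound 0 (1 + 2 * c)
        (∫⁻ r in Ici τ, ‖g₁ r - g₂ r‖ₑ ^ 2).toReal (t - τ) := by
  set ε := (∫⁻ r in Ici τ, ‖g₁ r - g₂ r‖ₑ ^ 2).toReal
  have hh : MemL2Loc τ fun r => g₁ r - g₂ r := fun T => (hg₁ T).sub (hg₂ T)
  have hwc : ContinuousOn (fun r => u₁ r - u₂ r) (Ici τ) := hu₁.continuousOn.sub hu₂.continuousOn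
  have hφc : ContinuousOn (fun r => ‖u₁ r - u₂ r‖ ^ 2) (Ici τ) := hwc.norm.pow 2
  have hφi : ∀ q, τ ≤ q → IntervalIntegrable (fun r => ‖u₁ r - u₂ r‖ ^ 2) volume τ q :=
    fun q hq => (hφc.mono (by rw [uIcc_of_le hq]; exact Icc_subset_Ici_self)).intervalIntegrable
  have hineq : ∀ q, τ ≤ q →
      ‖u₁ q - u₂ q‖ ^ 2 ≤ ε + (1 + 2 * c) * ∫ r in τ..q, ‖u₁ r - u₂ r‖ ^ 2 := by
    intro q hq
    have h1 := IsWeakSolution.energy_inequality_sub hf hf_mono hg₁ hg₂ hu₁ hu₂ le_rfl hq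
    have h0 : ‖u₁ τ - u₂ τ‖ ^ 2 = 0 := by rw [hu₁.initial, hu₂.initial]; simp
    have i₁ : IntervalIntegrable (fun r => ‖g₁ r - g₂ r‖ ^ 2) volume τ q :=
      (intervalIntegrable_iff_integrableOn_Icc_of_le hq).2 (hh.integrableOn_norm_sq q)
    have i₂ : IntervalIntegrable (fun r => ‖g₁ r - g₂ r‖ * ‖u₁ r - u₂ r‖
        + (c - lam) * ‖u₁ r - u₂ r‖ ^ 2) volume τ q :=
      ((intervalIntegrable_iff_integrableOn_Icc_of_le hq).2
        (hh.integrableOn_norm_mul hwc.memL2Loc q)).add ((hφi q hq).const_mul _)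
    have h2 : 2 * ∫ r in τ..q, (‖g₁ r - g₂ r‖ * ‖u₁ r - u₂ r‖
        + (c - lam) * ‖u₁ r - u₂ r‖ ^ 2)
        ≤ ∫ r in τ..q, (‖g₁ r - g₂ r‖ ^ 2 + (1 + 2 * c) * ‖u₁ r - u₂ r‖ ^ 2) := by
      rw [← intervalIntegral.integral_const_mul]
      refine intervalIntegral.integral_mono_on hq (i₂.const_mul 2)
        (i₁.add ((hφi q hq).const_mul _)) fun r _ => ?_
      -- `2 a b ≤ a² + b²`, and the damping is dropped
      nlinarith [sq_nonneg (‖g₁ r - g₂ r‖ - ‖u₁ r - u₂ r‖),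
        mul_nonneg hlam (sq_nonneg ‖u₁ r - u₂ r‖)]
    rw [intervalIntegral.integral_add i₁ ((hφi q hq).const_mul _),
      intervalIntegral.integral_const_mul] at h2
    have h3 := integral_norm_sq_le hh hfin le_rfl hq
    linarith
  have hnn : ∀ q, τ ≤ q → 0 ≤ ∫ r in τ..q, ‖u₁ r - u₂ r‖ ^ 2 := fun q hq =>
    intervalIntegral.integral_nonneg hq fun r _ => sq_nonneg _
  have hgron : ∫ r in τ..t, ‖u₁ r - u₂ r‖ ^ 2 ≤ gronwallBound 0 (1 + 2 * c) ε (t - τ) := by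
    refine (le_abs_self _).trans ?_
    refine norm_le_gronwallBound_of_norm_deriv_right_le (a := τ) (b := t)
      (f := fun q => ∫ r in τ..q, ‖u₁ r - u₂ r‖ ^ 2) (f' := fun q => ‖u₁ q - u₂ q‖ ^ 2)
      ?_ (fun q hq => ?_) (by simp) (fun q hq => ?_) t (right_mem_Icc.2 ht)
    · exact intervalIntegral.continuousOn_primitive_interval
        ((intervalIntegrable_iff').1 (hφi t ht)) |>.mono (by rw [uIcc_of_le ht])
    · have hci : ContinuousWithinAt (fun r => ‖u₁ r - u₂ r‖ ^ 2) (Ici q) q :=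
        (hφc q hq.1).mono (Ici_subset_Ici.2 hq.1)
      refine intervalIntegral.integral_hasDerivWithinAt_right (hφi q hq.1)
        (s := Ici q) (t := Ioi q) ?_ (hci.mono Ioi_subset_Ici_self)
      exact (hφc.mono fun r hr => hq.1.trans (le_of_lt hr)).stronglyMeasurableAtFilter_nhdsWithin
        measurableSet_Ioi q
    · rw [Real.norm_eq_abs, Real.norm_eq_abs, abs_of_nonneg (sq_nonneg _),
        abs_of_nonneg (hnn q hq.1)]
      linarith [hineq q hq.1]
  have := mul_le_mul_of_nonneg_left hgron (by linarith : 0 ≤ 1 + 2 * c)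
  linarith [hineq t ht]

/-- A bound obtained by starting from the last time before `b` at which `φ` is at most
`max (φ a) M`. -/
theorem le_max_add_of_last_time {φ : ℝ → ℝ} {a b M E : ℝ} (hab : a ≤ b)
    (hφ : ContinuousOn φ (Icc a b))
    (h : ∀ s ∈ Icc a b, (∀ r ∈ Ioc s b, M < φ r) → φ b ≤ φ s + E) :
    φ b ≤ max (φ a) M + E := by
  have hcl : IsCompact (Icc a b ∩ φ ⁻¹' Iic (max (φ a) M)) :=
    isCompact_Icc.of_isClosed_subset (hφ.preimage_isClosed_of_isClosed isClosed_Icc isClosed_Iic)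
      inter_subset_left
  obtain ⟨s, hs, hmax⟩ := hcl.exists_isGreatest ⟨a, left_mem_Icc.2 hab, le_max_left (φ a) M⟩
  have h1 := h s hs.1 fun r hr => by
    by_contra hcon
    have h2 := hmax ⟨⟨hs.1.1.trans hr.1.le, hr.2⟩, le_max_of_le_right (not_lt.1 hcon)⟩
    exact absurd hr.1 (not_lt.2 h2)
  have h3 : φ s ≤ max (φ a) M := hs.2
  linarith

/-- Weak solutions are bounded on `[τ, ∞)` when the forcing differs from a constant one by an
element of `L²([τ, ∞); L²(ℝ))`: above the level `2 ‖g₀‖² / lam²` the damping absorbs `g₀`. -/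
theorem IsWeakSolution.norm_sq_le (hf : Continuous f) (hf_sign : ∀ r, 0 ≤ f r * r)
    (hlam : 0 < lam) (hg : MemL2Loc τ g) {g₀ : L2R}
    (hfin : ∫⁻ r in Ici τ, ‖g r - g₀‖ₑ ^ 2 ≠ ∞)
    (hu : IsWeakSolution lam f g τ u₀ u) (ht : τ ≤ t) :
    ‖u t‖ ^ 2 ≤ max (‖u₀‖ ^ 2) (2 * ‖g₀‖ ^ 2 / lam / lam)
      + 2 / lam * (∫⁻ r in Ici τ, ‖g r - g₀‖ₑ ^ 2).toReal := by
  have hh : MemL2Loc τ fun r => g r - g₀ := fun T => (hg T).sub (memLp_const g₀)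
  have hφc : ContinuousOn (fun r => ‖u r‖ ^ 2) (Ici τ) := hu.continuousOn.norm.pow 2
  rw [← hu.initial]
  refine le_max_add_of_last_time (φ := fun r => ‖u r‖ ^ 2) ht (hφc.mono Icc_subset_Ici_self)
    fun s hs habove => ?_
  have h1 := hu.energy_inequality hf hf_sign hg hs.1 hs.2
  have hsub : Icc s t ⊆ Icc τ t := Icc_subset_Icc_left hs.1
  have i₁ : IntervalIntegrable (fun r => ‖g r - g₀‖ ^ 2) volume s t :=
    (intervalIntegrable_iff_integrableOn_Icc_of_le hs.2).2
      ((hh.integrableOn_norm_sq t).mono_set hsub)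
  have i₂ : IntervalIntegrable (fun r => ‖g r‖ * ‖u r‖ + (0 - lam) * ‖u r‖ ^ 2) volume s t :=
    (intervalIntegrable_iff_integrableOn_Icc_of_le hs.2).2
      (((hg.integrableOn_norm_mul hu.continuousOn.memL2Loc t).add
        ((hu.continuousOn.memL2Loc.integrableOn_norm_sq t).const_mul _)).mono_set hsub)
  have h2 : 2 * ∫ r in s..t, (‖g r‖ * ‖u r‖ + (0 - lam) * ‖u r‖ ^ 2)
      ≤ ∫ r in s..t, 2 / lam * ‖g r - g₀‖ ^ 2 := by
    rw [← intervalIntegral.integral_const_mul]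
    refine intervalIntegral.integral_mono_on_of_le_Ioo hs.2 (i₂.const_mul 2) (i₁.const_mul _)
      fun r hr => ?_
    have hM := habove r (Ioo_subset_Ioc_self hr)
    rw [div_lt_iff₀ hlam, div_lt_iff₀ hlam] at hM
    have htri : ‖g r‖ ≤ ‖g r - g₀‖ + ‖g₀‖ := by
      simpa using norm_add_le (g r - g₀) g₀
    have hsq : ‖g r‖ ^ 2 ≤ 2 * ‖g r - g₀‖ ^ 2 + 2 * ‖g₀‖ ^ 2 := by
      nlinarith [norm_nonneg (g r), sq_nonneg (‖g r - g₀‖ - ‖g₀‖)]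
    rw [div_mul_eq_mul_div, le_div_iff₀ hlam]
    -- `2 ‖g‖ ‖u‖ ≤ ‖g‖² / lam + lam ‖u‖²`, so half of the damping is left to absorb `g₀`
    nlinarith [sq_nonneg (‖g r‖ - lam * ‖u r‖)]
  rw [intervalIntegral.integral_const_mul] at h2
  have h3 := integral_norm_sq_le hh hfin hs.1 hs.2
  have h4 := mul_le_mul_of_nonneg_left h3 (by positivity : 0 ≤ 2 / lam)
  linarith

theorem sub_mul_sub_ge_of_deriv_ge (hf : Differentiable ℝ f) (hf' : ∀ r, -c ≤ deriv f r)
    (a b : ℝ) : -c * (a - b) ^ 2 ≤ (f a - f b) * (a - b) := by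
  have hmono : Monotone fun r => f r + c * r := by
    refine monotone_of_deriv_nonneg (hf.add (differentiable_id.const_mul c)) fun r => ?_
    have := ((hf r).hasDerivAt.add ((hasDerivAt_id r).const_mul c)).deriv
    have h2 : deriv (fun r => f r + c * r) r = deriv f r + c * 1 := this
    rw [h2]
    linarith [hf' r]
  rcases le_total a b with h | h
  · have := hmono h
    simp only at this
    nlinarith
  · have := hmono h
    simp only at this
    nlinarith

end Estimates

/-! ### Convergence of the attractors -/

section Convergence

variable {X : Type*} [MetricSpace X]

/-- If the fibres of an invariant family are eventually bounded and the process approaches, over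
each time span and uniformly on bounded sets, a semigroup with a global attractor, then the fibres
converge to that attractor. -/
theorem tendsto_hausdorffSemiDist_of_asymptotically_autonomous {U : ℝ → ℝ → X → X}
    {S : ℝ → X → X} {A : ℝ → Set X} {Ainf D : Set X} (hA : IsInvariantFamily U A)
    (hAinf : IsGlobalAttractor S Ainf) (hD : Bornology.IsBounded D) (hne : D.Nonempty)
    (hAD : ∀ᶠ τ in atTop, A τ ⊆ D)
    (hUS : ∀ T, 0 ≤ T → ∀ ε > 0, ∀ᶠ τ in atTop, ∀ x ∈ D, dist (U (τ + T) τ x) (S T x) < ε) :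
    Tendsto (fun t => hausdorffSemiDist (A t) Ainf) atTop (𝓝 0) := by
  refine ENNReal.tendsto_nhds_zero.2 fun ε hε => ?_
  have hε2 : 0 < ε / 2 := ENNReal.half_pos hε.ne'
  obtain ⟨δ, hδ0, hδ⟩ := ENNReal.lt_iff_exists_nnreal_btwn.1 hε2
  obtain ⟨T, hT, hT0⟩ := ((ENNReal.tendsto_nhds_zero.1 (hAinf.attracts D hne hD) _ hε2).and
    (eventually_ge_atTop 0)).exists
  have hev := (hUS T hT0 δ (by exact_mod_cast hδ0)).and hAD
  have hshift : Tendsto (fun t : ℝ => t - T) atTop atTop :=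
    tendsto_atTop_add_const_right _ (-T) tendsto_id
  filter_upwards [hshift.eventually hev] with t ht
  refine iSup₂_le fun a ha => ?_
  rw [← hA (t - T) t (by linarith)] at ha
  obtain ⟨b, hb, rfl⟩ := ha
  have h1 := ht.1 b (ht.2 hb)
  rw [sub_add_cancel] at h1
  have h2 : edist (U t (t - T) b) (S T b) ≤ ε / 2 := by
    refine le_trans (le_of_lt ?_) hδ.le
    rw [edist_dist, ← ENNReal.ofReal_coe_nnreal]
    exact ENNReal.ofReal_lt_ofReal_iff_of_nonneg dist_nonneg |>.2 h1
  have h3 : Metric.infEDist (S T b) Ainf ≤ ε / 2 :=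
    (le_iSup₂ (f := fun a (_ : a ∈ S T '' D) => Metric.infEDist a Ainf) (S T b)
      (mem_image_of_mem _ (ht.2 hb))).trans hT
  calc Metric.infEDist (U t (t - T) b) Ainf
      ≤ Metric.infEDist (S T b) Ainf + edist (U t (t - T) b) (S T b) :=
        Metric.infEDist_le_infEDist_add_edist
    _ ≤ ε / 2 + ε / 2 := add_le_add h3 h2
    _ = ε := ENNReal.add_halves ε

end Convergence

theorem theorem4p2
    -- the coefficient, the growth exponent and the constant in the conditions on the nonlinearity
    (lam p c : ℝ) (hlam : 0 < lam) (hp : 0 ≤ p)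
    (f : ℝ → ℝ) (hf : ContDiff ℝ 1 f)
    (hf_sign : ∀ r, 0 ≤ f r * r) (hf_zero : f 0 = 0)
    (hf_deriv : ∀ r, -c ≤ deriv f r)
    (hf_growth : ∀ r, |deriv f r| ≤ c * (1 + |r| ^ p))
    -- the forcing is in `L²_loc(ℝ; L²(ℝ))` and tempered; the limiting forcing is in `L²(ℝ)`
    (g : ℝ → L2R) (hg : ∀ τ, MemL2Loc τ g)
    (hg_tempered : IntegrableOn (fun s => Real.exp (lam * s) * ‖g s‖ ^ 2) (Iic 0))
    (g₀ : L2R)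
    -- `U` and `S` are the solution maps of the two uniquely solvable problems
    (U : ℝ → ℝ → L2R → L2R)
    (hU : ∀ τ u₀, IsUniqueWeakSolution lam f g τ u₀ (fun t => U t τ u₀))
    (S : ℝ → L2R → L2R)
    (hS : ∀ u₀, IsUniqueWeakSolution lam f (fun _ => g₀) 0 u₀ (fun t => S t u₀))
    -- the attractors
    (A : ℝ → Set L2R) (hA : IsPullbackAttractor U A)
    (Ainf : Set L2R) (hAinf : IsGlobalAttractor S Ainf)
    -- the forcing is asymptotically autonomous
    (hconv : Tendsto (fun τ => ∫⁻ s in Ici τ, ‖g s - g₀‖ₑ ^ 2) atTop (𝓝 0)) :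
    Tendsto (fun t => hausdorffSemiDist (A t) Ainf) atTop (𝓝 0) := by
  have hc : 0 ≤ c := by
    have h1 : 0 ≤ c * (1 + |(0 : ℝ)| ^ p) := (abs_nonneg _).trans (hf_growth 0)
    exact nonneg_of_mul_nonneg_left h1 (by positivity)
  have hmono := sub_mul_sub_ge_of_deriv_ge (hf.differentiable one_ne_zero) hf_deriv
  have hfin : ∀ᶠ τ in atTop, ∫⁻ s in Ici τ, ‖g s - g₀‖ₑ ^ 2 ≠ ∞ :=
    (hconv.eventually (gt_mem_nhds ENNReal.zero_lt_top)).mono fun τ h => h.ne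
  -- the fibres of the pullback attractor are bounded uniformly in the future of some time `τ₀`
  obtain ⟨τ₀, hτ₀⟩ := hfin.exists
  obtain ⟨R₀, hR₀⟩ := (hA.compact τ₀).2.isBounded.exists_norm_le
  set M : ℝ := max (R₀ ^ 2) (2 * ‖g₀‖ ^ 2 / lam / lam)
      + 2 / lam * (∫⁻ r in Ici τ₀, ‖g r - g₀‖ₑ ^ 2).toReal with hM
  have hAD : ∀ τ, τ₀ ≤ τ → A τ ⊆ Metric.closedBall 0 (√M) := by
    intro τ hτ a ha
    rw [← hA.invariant τ₀ τ hτ] at ha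
    obtain ⟨b, hb, rfl⟩ := ha
    rw [mem_closedBall_zero_iff]
    refine Real.le_sqrt_of_sq_le ?_
    refine ((hU τ₀ b).1.norm_sq_le hf.continuous hf_sign hlam (hg τ₀) hτ₀ hτ).trans ?_
    have hb' : ‖b‖ ^ 2 ≤ R₀ ^ 2 := pow_le_pow_left₀ (norm_nonneg b) (hR₀ b hb) 2
    rw [hM]
    gcongr
  refine tendsto_hausdorffSemiDist_of_asymptotically_autonomous hA.invariant hAinf
    (D := Metric.closedBall 0 (√M)) Metric.isBounded_closedBall
    ⟨0, Metric.mem_closedBall_self (Real.sqrt_nonneg _)⟩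
    ((eventually_ge_atTop τ₀).mono hAD) fun T hT ε hε => ?_
  -- the bound for `‖U (τ + T) τ x - S T x‖²` tends to zero as `τ → ∞`, independently of `x`
  have hδ : Tendsto (fun τ => (∫⁻ s in Ici τ, ‖g s - g₀‖ₑ ^ 2).toReal) atTop (𝓝 0) := by
    rw [← ENNReal.toReal_zero]
    exact (ENNReal.tendsto_toReal ENNReal.zero_ne_top).comp hconv
  have hbound : Tendsto (fun τ => (∫⁻ s in Ici τ, ‖g s - g₀‖ₑ ^ 2).toReal
      + (1 + 2 * c) * gronwallBound 0 (1 + 2 * c)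
        (∫⁻ s in Ici τ, ‖g s - g₀‖ₑ ^ 2).toReal T) atTop (𝓝 0) := by
    have h1 := ((gronwallBound_continuous_ε 0 (1 + 2 * c) T).tendsto 0).comp hδ
    rw [gronwallBound_ε0_δ0] at h1
    simpa using hδ.add (h1.const_mul (1 + 2 * c))
  filter_upwards [hfin, hbound.eventually (gt_mem_nhds (pow_pos hε 2))] with τ hτ hlt x _
  have hτT : τ ≤ τ + T := by linarith
  have h1 := IsWeakSolution.norm_sub_sq_le hf.continuous hlam.le hc hmono (hg τ)
    (fun _ => memLp_const g₀) (hU τ x).1 ((hS x).1.shift τ) hτ hτT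
  rw [add_sub_cancel_left] at h1
  rw [dist_eq_norm]
  exact lt_of_pow_lt_pow_left₀ 2 hε.le (h1.trans_lt hlt)
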